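/- Consider a lottery contest with $n\ge 3$ homogeneous agents of unit cost $c>0$: at an output profile $x\in\mathbb R_{\ge 0}^n$ agent $i$ has utility $u_i(x)=\frac{x_i}{\sum_j x_j}-c\,x_i$ (the first term is $1/n$ if $x=0$). For $\epsilon\in(0,1)$, a profile $x$ is an $\epsilon$-approximate equilibrium if $u_i(x)\ge(1-\epsilon)\,u_i(z,x_{-i})$ for every agent $i$ and every $z\ge 0$. Fix $a>0$ with $ca<1/4$. Writing $S=\sum_{j\ne i}x_j$, the best response of agent $i$ is $a$ if $S=0$, is $\sqrt{S/c}-S$ if $0<S\le 1/c$, and is $0$ if $S>1/c$. In the dynamics with uniform selection, starting from $x_0\in\mathbb R_{\ge0}^n$, at each time $t=0,1,2,\dots$ an agent $i_t$, chosen uniformly at random and independently of the past, replaces her output by her best response to $x_t$, and all other outputs stay the same; this gives $x_{t+1}$. Let $T_\epsilon\in\{0,1,2,\dots\}\cup\{\infty\}$ be the first time $t$ at which $x_t$ is an $\epsilon$-approximate equilibrium. Put $$\gamma(x_0)=\min\bigl(A\cup B\cup\{ca\}\bigr),\quad A=\{c\,x_{0,i} : 0<c\,x_{0,i}<1\},\quad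 B=\Bigl\{\sqrt{(1-\sqrt y)/2} : y\in A\Bigr\}.$$ (1) Upper bound. There is an absolute constant $C>0$ such that for all $n\ge3$, all $c,a$ as above, every initial profile $x_0\in\mathbb R_{\ge 0}^n$ and all $\epsilon,\delta\in(0,1)$, $$\Pr\Bigl[T_\epsilon\le C\Bigl(\log\log\tfrac1{\gamma(x_0)}+n\log\tfrac{n}{\epsilon\delta}\Bigr)\Bigr]\ge 1-\delta.$$ (2) Lower bound (worst case over initial profiles). There is an absolute constant $c_0>0$ such that for all $n\ge3$, all $c,a$ as above and every $\gamma\in(0,ca]$ there is an initial profile $x_0\in\mathbb R_{\ge 0}^n$ with $\gamma(x_0)=\gamma$ such that for all $\epsilon,\delta\in(0,1)$, $$\Pr\Bigl[T_\epsilon\ge c_0\Bigl(n\max\{0,\log(n\delta)\}+\max\bigl\{0,\ \log\log\tfrac1\epsilon+\log\log\tfrac1\gamma\bigr\}\Bigr)\Bigr]\ge 1-\delta.$$ -/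

import Mathlib

open MeasureTheory Finset

noncomputable section

namespace LotteryContest

/-- Total output of all agents other than `i`. -/
def othersOutput {n : ℕ} (x : Fin n → ℝ) (i : Fin n) : ℝ :=
  ∑ j ∈ univ.erase i, x j

/-- Utility of agent `i` with unit cost `κ` at the profile `x`: the share of the unit prize
(`1/n` if nobody produces anything) minus the cost of the own output. -/
def utility {n : ℕ} (κ : ℝ) (i : Fin n) (x : Fin n → ℝ) : ℝ :=
  (if ∑ j, x j = 0 then 1 / (n : ℝ) else x i / ∑ j, x j) - κ * x i

/-- Best response of an agent with unit cost `κ` when the other agents produce `S ≥ 0` in total;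
the convention is that the agent plays `a` if all the others play `0`. -/
def bestResponse (κ a S : ℝ) : ℝ :=
  if S = 0 then a else if S ≤ 1 / κ then √(S / κ) - S else 0

/-- Best-response dynamics: `i t` is the agent who moves at time `t`. -/
def profile {n : ℕ} (κ a : ℝ) (x₀ : Fin n → ℝ) (i : ℕ → Fin n) : ℕ → Fin n → ℝ
  | 0 => x₀
  | t + 1 =>
    Function.update (profile κ a x₀ i t) (i t)
      (bestResponse κ a (othersOutput (profile κ a x₀ i t) (i t)))

/-- `ε`-approximate pure-strategy Nash equilibrium with homogeneous unit cost `κ`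
(actions are non-negative outputs, the error is multiplicative). -/
def IsApproxEquilibrium {n : ℕ} (κ ε : ℝ) (x : Fin n → ℝ) : Prop :=
  ∀ i : Fin n, ∀ z : ℝ, 0 ≤ z →
    (1 - ε) * utility κ i (Function.update x i z) ≤ utility κ i x

/-- The positive normalized initial outputs `κ * x₀ i` that are smaller than `1`. -/
def smallOutputs {n : ℕ} (κ : ℝ) (x₀ : Fin n → ℝ) : Set ℝ :=
  {y | 0 < y ∧ y < 1 ∧ ∃ i, y = κ * x₀ i}

/-- The parameter `γ = min (A ∪ B ∪ {κ a})` of the initial profile, where `A` is the set of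
positive normalized outputs below `1` and `B = {√((1 - √y) / 2) | y ∈ A}`.
The set is finite and non-empty, so the infimum is a minimum. -/
def startParam {n : ℕ} (κ a : ℝ) (x₀ : Fin n → ℝ) : ℝ :=
  sInf (smallOutputs κ x₀ ∪ (fun y => √((1 - √y) / 2)) '' smallOutputs κ x₀ ∪ {κ * a})

/-- The law of the sequence of movers: independent, each uniform on the `n` agents. -/
def uniformMovers (n : ℕ) [NeZero n] : Measure (ℕ → Fin n) :=
  Measure.infinitePi fun _ : ℕ => (PMF.uniformOfFintype (Fin n)).toMeasure

end LotteryContest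

end

/-!
After measuring outputs in units of the inverse cost, the unit cost is `1`. Let `s` be the total
output and `S i = s - x i` the aggregate output of the opponents of agent `i`. If `0 < S i ≤ 1`, a
move of agent `i` brings the total to `√(S i)`, and the loss of utility of agent `i` relative to the
optimum `(1 - √(S i)) ^ 2` is `(s - √(S i)) ^ 2 / s` (`utility_eq`), which makes approximate
equilibria explicit (`isApproxEquilibrium_iff`).

The movers are independent and uniform, so the law of the profile at time `t` is given by iterating
the averaging operator `avg` of the chain (`integral_profile`). All probabilistic estimates are
Markov's inequality for a function with a multiplicative drift on a region closed under moves
(`stepProb_le_of_drift`), and they are chained by `stepProb_add_le`.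

**Upper bound.** A non-degeneracy condition is preserved by all moves and keeps the total output at
least `γ` after the first move (`Admissible.step`, `Admissible.le_total_step`). Convergence then has
three stages. First, once every agent with a large output has moved, all outputs are at most `1 / 4`
and the total is at most `1`; this is coupon collecting and takes about `n * log (n / δ)` moves
(`avg_obstruction_le`). Second, while `s < 1 / 2`, the last mover holds `s - s ^ 2`, so at least a
third of the agents raise the total to at least `√(3 * s / 4)` if they move, and nobody lowers it:
the logarithmic deficit of `s` decays geometrically in expectation, and `log (log (1 / γ))` moves
suffice up to constants (`avg_deficit_le`). Third, the function
`(∑ k, x k ^ 2) / 2 - s ^ 2 / 2 + s ^ 3 / 3` is a potential that every best response minimizes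
exactly in its own coordinate, and it is strongly convex for `s ≥ 1 / 2`. This is random
exact coordinate descent, which contracts the excess of the potential by `1 - 1 / (3 * n)` per move
(`ConvexRegion.avg_excess_le`), and a small excess forces an approximate equilibrium.

**Lower bound.** The initial profile has outputs `γ`, `2 * γ` and otherwise zeros. An agent with
zero output rules out an approximate equilibrium for every `ε < 1`, and the number `z` of such agents
satisfies `E[1 / (z + 1)] ≤ (1 + 1 / n) ^ t / (n - 1)` (`Interior.avg_inv_zeros_le`); this gives
the term `n * log (n * δ)`. The doubly logarithmic terms hold along every trajectory
(`log_log_add_log_log_le`): a move raises the total output at most to its square root, and the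
distance to the Nash equilibrium shrinks at most by a factor of order `n` per move. The latter loses
only a factor `t ^ 2` in `log (1 / ε)`, since `n ≤ t + 2` as soon as no agent is idle.
-/

namespace LotteryContest

/-! ### Averaging over the mover -/

section Averaging

variable {X : Type*} {n : ℕ}

/-- The transition operator of the Markov chain on `X` that moves from `x` to `F x i`, where `i`
is uniform on `Fin n`: it sends `g` to the expectation of `g` after one step. -/
noncomputable def avg (F : X → Fin n → X) (g : X → ℝ) (x : X) : ℝ := (∑ i, g (F x i)) / n

open Classical in
/-- The probability that the chain with moves `F`, started at `x`, satisfies `B` after `t`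
steps. -/
noncomputable def stepProb (F : X → Fin n → X) (t : ℕ) (B : X → Prop) (x : X) : ℝ :=
  (avg F)^[t] (fun y => if B y then 1 else 0) x

variable {F : X → Fin n → X}

theorem avg_mono {g h : X → ℝ} {x : X} (H : ∀ i, g (F x i) ≤ h (F x i)) :
    avg F g x ≤ avg F h x :=
  div_le_div_of_nonneg_right (sum_le_sum fun i _ => H i) (Nat.cast_nonneg n)

theorem avg_const [NeZero n] (c : ℝ) (x : X) : avg F (fun _ => c) x = c := by
  have : (n : ℝ) ≠ 0 := Nat.cast_ne_zero.2 (NeZero.ne n)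
  simp [avg, this]

theorem avg_add (g h : X → ℝ) (x : X) :
    avg F (fun y => g y + h y) x = avg F g x + avg F h x := by
  simp [avg, sum_add_distrib, add_div]

theorem avg_const_mul (c : ℝ) (g : X → ℝ) (x : X) :
    avg F (fun y => c * g y) x = c * avg F g x := by
  simp [avg, ← mul_sum, mul_div_assoc]

theorem avg_iterate_mono {R : X → Prop} (hR : ∀ x, R x → ∀ i, R (F x i)) {g h : X → ℝ}
    (H : ∀ x, R x → g x ≤ h x) (t : ℕ) {x : X} (hx : R x) :
    (avg F)^[t] g x ≤ (avg F)^[t] h x := by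
  induction t generalizing x with
  | zero => exact H x hx
  | succ t ih =>
    rw [Function.iterate_succ_apply', Function.iterate_succ_apply']
    exact avg_mono fun i => ih (hR x hx i)

/-- A function that decays by the factor `ρ` in expectation on a closed region decays
geometrically. -/
theorem avg_iterate_le_pow_mul {R : X → Prop} (hR : ∀ x, R x → ∀ i, R (F x i)) {V : X → ℝ}
    {ρ : ℝ} (hρ : 0 ≤ ρ) (hV : ∀ x, R x → avg F V x ≤ ρ * V x) (t : ℕ) {x : X} (hx : R x) :
    (avg F)^[t] V x ≤ ρ ^ t * V x := by
  induction t generalizing x with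
  | zero => simp
  | succ t ih =>
    rw [Function.iterate_succ_apply']
    calc avg F ((avg F)^[t] V) x ≤ avg F (fun y => ρ ^ t * V y) x :=
          avg_mono fun i => ih (hR x hx i)
      _ = ρ ^ t * avg F V x := avg_const_mul _ _ _
      _ ≤ ρ ^ t * (ρ * V x) := mul_le_mul_of_nonneg_left (hV x hx) (pow_nonneg hρ t)
      _ = ρ ^ (t + 1) * V x := by ring

theorem avg_iterate_const_mul (c : ℝ) (g : X → ℝ) (t : ℕ) (x : X) :
    (avg F)^[t] (fun y => c * g y) x = c * (avg F)^[t] g x := by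
  induction t generalizing x with
  | zero => rfl
  | succ t ih =>
    rw [Function.iterate_succ_apply', Function.iterate_succ_apply', ← avg_const_mul]
    simp only [avg, ih]

/-- Markov's inequality for a chain with a function `V` that drifts by the factor `ρ`. -/
theorem stepProb_le_of_drift {R : X → Prop} (hR : ∀ x, R x → ∀ i, R (F x i)) {V : X → ℝ}
    {ρ m : ℝ} (hρ : 0 ≤ ρ) (hm : 0 < m) (hV0 : ∀ x, R x → 0 ≤ V x)
    (hV : ∀ x, R x → avg F V x ≤ ρ * V x) {B : X → Prop} (hB : ∀ x, R x → B x → m ≤ V x)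
    (t : ℕ) {x : X} (hx : R x) :
    stepProb F t B x ≤ ρ ^ t * V x / m := by
  classical
  calc stepProb F t B x ≤ (avg F)^[t] (fun y => m⁻¹ * V y) x := by
        refine avg_iterate_mono hR (fun y hy => ?_) t hx
        split_ifs with h
        · rw [inv_mul_eq_div, one_le_div hm]
          exact hB y hy h
        · exact mul_nonneg (inv_nonneg.2 hm.le) (hV0 y hy)
    _ = m⁻¹ * (avg F)^[t] V x := avg_iterate_const_mul _ _ _ _
    _ ≤ m⁻¹ * (ρ ^ t * V x) :=
        mul_le_mul_of_nonneg_left (avg_iterate_le_pow_mul hR hρ hV t hx) (inv_nonneg.2 hm.le)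
    _ = ρ ^ t * V x / m := by rw [inv_mul_eq_div]

theorem stepProb_succ (t : ℕ) (B : X → Prop) (x : X) :
    stepProb F (t + 1) B x = avg F (stepProb F t B) x := by
  unfold stepProb
  rw [Function.iterate_succ_apply']

theorem stepProb_le_one [NeZero n] (t : ℕ) (B : X → Prop) (x : X) : stepProb F t B x ≤ 1 := by
  induction t generalizing x with
  | zero =>
    simp only [stepProb, Function.iterate_zero, id]
    split_ifs <;> norm_num
  | succ t ih =>
    rw [stepProb_succ, ← avg_const (F := F) 1 x]
    exact avg_mono fun i => ih _

theorem stepProb_succ_le [NeZero n] {t : ℕ} {B : X → Prop} {x : X} {p : ℝ}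
    (h : ∀ i, stepProb F t B (F x i) ≤ p) : stepProb F (t + 1) B x ≤ p := by
  rw [stepProb_succ, ← avg_const (F := F) p x]
  exact avg_mono h

/-- If the chain misses `B'` after `t` steps up to probability `p`, and misses `B` after `s` more
steps up to probability `q` whenever it starts outside `B'`, then it misses `B` after `t + s` steps
up to probability `p + q`. -/
theorem stepProb_add_le [NeZero n] {R : X → Prop} (hR : ∀ x, R x → ∀ i, R (F x i))
    {B B' : X → Prop} {t s : ℕ} {p q : ℝ} {x : X} (hx : R x) (hq : 0 ≤ q)
    (h₁ : stepProb F t B' x ≤ p) (h₂ : ∀ y, R y → ¬ B' y → stepProb F s B y ≤ q) :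
    stepProb F (t + s) B x ≤ p + q := by
  classical
  induction t generalizing x p with
  | zero =>
    rw [zero_add]
    by_cases hb : B' x
    · have : (1 : ℝ) ≤ p := by simpa [stepProb, hb] using h₁
      linarith [stepProb_le_one (F := F) s B x]
    · have : (0 : ℝ) ≤ p := by simpa [stepProb, hb] using h₁
      linarith [h₂ x hx hb]
  | succ t ih =>
    rw [Nat.add_right_comm, stepProb_succ]
    calc avg F (stepProb F (t + s) B) x ≤ avg F (fun y => stepProb F t B' y + q) x :=
          avg_mono fun i => ih (hR x hx i) le_rfl
      _ = stepProb F (t + 1) B' x + q := by rw [avg_add, avg_const, stepProb_succ]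
      _ ≤ p + q := by linarith

end Averaging

section Law

/-- One move of agent `i` in the best-response dynamics. -/
noncomputable def step {n : ℕ} (κ a : ℝ) (x : Fin n → ℝ) (i : Fin n) : Fin n → ℝ :=
  Function.update x i (bestResponse κ a (othersOutput x i))

theorem profile_succ {n : ℕ} (κ a : ℝ) (x₀ : Fin n → ℝ) (ω : ℕ → Fin n) (t : ℕ) :
    profile κ a x₀ ω (t + 1) = step κ a (profile κ a x₀ ω t) (ω t) := rfl

theorem profile_congr {n : ℕ} (κ a : ℝ) (x₀ : Fin n → ℝ) (t : ℕ) (ω ω' : ℕ → Fin n)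
    (h : ∀ s < t, ω s = ω' s) : profile κ a x₀ ω t = profile κ a x₀ ω' t := by
  induction t with
  | zero => rfl
  | succ t ih =>
    rw [profile_succ, profile_succ, ih fun s hs => h s (hs.trans t.lt_succ_self),
      h t t.lt_succ_self]

variable {n : ℕ} [NeZero n]

instance : IsProbabilityMeasure (uniformMovers n) := by
  unfold uniformMovers
  infer_instance

/-- The mover at time `t` is uniform and independent of everything determined by the earlier
movers. -/
theorem integral_mover (t : ℕ) (f : (ℕ → Fin n) → Fin n → ℝ)
    (hf : ∀ ω ω' : ℕ → Fin n, (∀ s < t, ω s = ω' s) → f ω = f ω') :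
    ∫ ω, f ω (ω t) ∂uniformMovers n = (∑ i, ∫ ω, f ω i ∂uniformMovers n) / n := by
  classical
  set μ := uniformMovers n with hμ
  set past : (ℕ → Fin n) → (range t → Fin n) := fun ω s => ω s with hpast
  -- `f ω` is a function of the finitely many movers before time `t`
  obtain ⟨g, hg⟩ : ∃ g : (range t → Fin n) → Fin n → ℝ, ∀ ω, f ω = g (past ω) := by
    refine ⟨fun w => f (fun s => if h : s ∈ range t then w ⟨s, h⟩ else 0), fun ω => hf _ _ ?_⟩
    intro s hs
    simp [hpast, hs]
  have hmpast : Measurable past := measurable_pi_lambda _ fun s => measurable_pi_apply _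
  have hmt : Measurable fun ω : ℕ → Fin n => ω t := measurable_pi_apply t
  have hind : ProbabilityTheory.IndepFun past (fun ω : ℕ → Fin n => ω t) μ := by
    have h := (ProbabilityTheory.iIndepFun_infinitePi
      (P := fun _ : ℕ => (PMF.uniformOfFintype (Fin n)).toMeasure)
      (X := fun _ x => x) (fun _ => measurable_id)).indepFun_finset (range t) {t}
      (by simp) (fun i => measurable_pi_apply i)
    exact h.comp (φ := id) (ψ := fun w : ({t} : Finset ℕ) → Fin n => w ⟨t, by simp⟩)
      measurable_id (measurable_pi_apply _)
  have hmap : μ.map (fun ω : ℕ → Fin n => ω t) = (PMF.uniformOfFintype (Fin n)).toMeasure :=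
    Measure.infinitePi_map_eval _ t
  have hcoord : ∀ i : Fin n, ∫ ω, (if ω t = i then (1 : ℝ) else 0) ∂μ = 1 / n := by
    intro i
    have h1 : ∫ ω, (if ω t = i then (1 : ℝ) else 0) ∂μ
        = ∫ k, (if k = i then (1 : ℝ) else 0) ∂(μ.map fun ω : ℕ → Fin n => ω t) :=
      (integral_map (f := fun k : Fin n => if k = i then (1 : ℝ) else 0) hmt.aemeasurable
        (measurable_of_countable _).aestronglyMeasurable).symm
    rw [h1, hmap, PMF.integral_eq_sum]
    simp
  have hint : ∀ i : Fin n,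
      Integrable (fun ω => g (past ω) i * (if ω t = i then (1 : ℝ) else 0)) μ := by
    intro i
    have : (fun ω : ℕ → Fin n => g (past ω) i * (if ω t = i then (1 : ℝ) else 0))
        = (fun p : (range t → Fin n) × Fin n => g p.1 i * (if p.2 = i then (1 : ℝ) else 0)) ∘
          fun ω => (past ω, ω t) := rfl
    rw [this]
    refine Integrable.comp_measurable ?_ (hmpast.prodMk hmt)
    exact Integrable.of_finite
  calc ∫ ω, f ω (ω t) ∂μ
      = ∫ ω, ∑ i, g (past ω) i * (if ω t = i then (1 : ℝ) else 0) ∂μ := by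
        refine integral_congr_ae (Filter.Eventually.of_forall fun ω => ?_)
        simp [hg]
    _ = ∑ i, ∫ ω, g (past ω) i * (if ω t = i then (1 : ℝ) else 0) ∂μ :=
        integral_finsetSum _ fun i _ => hint i
    _ = ∑ i, (∫ ω, g (past ω) i ∂μ) * (1 / n) := by
        refine sum_congr rfl fun i _ => ?_
        rw [← hcoord i]
        exact hind.integral_fun_comp_mul_comp (f := fun w => g w i)
          (g := fun k => if k = i then (1 : ℝ) else 0) hmpast.aemeasurable hmt.aemeasurable
          (measurable_of_countable _).aestronglyMeasurable
          (measurable_of_countable _).aestronglyMeasurable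
    _ = (∑ i, ∫ ω, f ω i ∂μ) / n := by
        rw [← sum_mul, mul_one_div]
        simp only [hg]

theorem integrable_profile (κ a : ℝ) (x₀ : Fin n → ℝ) (g : (Fin n → ℝ) → ℝ) (t : ℕ) :
    Integrable (fun ω => g (profile κ a x₀ ω t)) (uniformMovers n) := by
  have : (fun ω => g (profile κ a x₀ ω t))
      = (fun w : range t → Fin n => g (profile κ a x₀
          (fun s => if h : s ∈ range t then w ⟨s, h⟩ else 0) t)) ∘ fun ω s => ω s := by
    funext ω
    refine congrArg g (profile_congr κ a x₀ t _ _ fun s hs => ?_)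
    simp [hs]
  rw [this]
  exact Integrable.comp_measurable Integrable.of_finite
    (measurable_pi_lambda _ fun s => measurable_pi_apply _)

theorem integral_profile (κ a : ℝ) (x₀ : Fin n → ℝ) (g : (Fin n → ℝ) → ℝ) (t : ℕ) :
    ∫ ω, g (profile κ a x₀ ω t) ∂uniformMovers n = (avg (step κ a))^[t] g x₀ := by
  induction t generalizing g with
  | zero => simp [profile]
  | succ t ih =>
    rw [Function.iterate_succ_apply, ← ih]
    simp only [profile_succ]
    rw [integral_mover t (fun ω i => g (step κ a (profile κ a x₀ ω t) i))
      fun ω ω' h => by rw [profile_congr κ a x₀ t ω ω' h]]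
    unfold avg
    rw [integral_div, integral_finsetSum]
    exact fun i _ => integrable_profile κ a x₀ (fun y => g (step κ a y i)) t

theorem measurableSet_profile (κ a : ℝ) (x₀ : Fin n → ℝ) (B : (Fin n → ℝ) → Prop) (t : ℕ) :
    MeasurableSet {ω : ℕ → Fin n | B (profile κ a x₀ ω t)} := by
  have : {ω : ℕ → Fin n | B (profile κ a x₀ ω t)}
      = (fun ω (s : range t) => ω s) ⁻¹' {w | B (profile κ a x₀
          (fun s => if h : s ∈ range t then w ⟨s, h⟩ else 0) t)} := by
    ext ω
    have : profile κ a x₀ ω t = profile κ a x₀ (fun s => if s ∈ range t then ω s else 0) t :=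
      profile_congr κ a x₀ t _ _ fun s hs => by simp [hs]
    simp only [Set.mem_ofPred_eq, Set.mem_preimage, dite_eq_ite, ← this]
  rw [this]
  exact (measurable_pi_lambda _ fun s => measurable_pi_apply _) (Set.toFinite _).measurableSet

theorem measureReal_profile (κ a : ℝ) (x₀ : Fin n → ℝ) (B : (Fin n → ℝ) → Prop) (t : ℕ) :
    (uniformMovers n).real {ω | B (profile κ a x₀ ω t)} = stepProb (step κ a) t B x₀ := by
  classical
  rw [stepProb, ← integral_profile, ← integral_indicator_one (measurableSet_profile κ a x₀ B t)]
  exact integral_congr_ae (Filter.Eventually.of_forall fun ω => by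
    simp [Set.indicator_apply])

/-- An event that holds whenever the profile at time `t` avoids `B` has probability at least
`1 - δ` if the profile satisfies `B` at time `t` with probability at most `δ`. -/
theorem one_sub_le_measureReal {κ a : ℝ} {x₀ : Fin n → ℝ} {B : (Fin n → ℝ) → Prop} {t : ℕ} {δ : ℝ}
    (hB : stepProb (step κ a) t B x₀ ≤ δ) {E : Set (ℕ → Fin n)}
    (hE : ∀ ω, ¬ B (profile κ a x₀ ω t) → ω ∈ E) :
    1 - δ ≤ (uniformMovers n).real E := by
  have h := probReal_compl_eq_one_sub (μ := uniformMovers n) (measurableSet_profile κ a x₀ B t)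
  rw [measureReal_profile] at h
  have h2 : (uniformMovers n).real {ω | B (profile κ a x₀ ω t)}ᶜ ≤ (uniformMovers n).real E :=
    measureReal_mono fun ω hω => hE ω hω
  linarith

end Law

/-! ### Normalization and single moves -/

section Scaling

variable {n : ℕ}

theorem othersOutput_mul (κ : ℝ) (x : Fin n → ℝ) (i : Fin n) :
    othersOutput (fun k => κ * x k) i = κ * othersOutput x i := by
  rw [othersOutput, othersOutput, mul_sum]

theorem mul_bestResponse {κ : ℝ} (hκ : 0 < κ) (a S : ℝ) :
    κ * bestResponse κ a S = bestResponse 1 (κ * a) (κ * S) := by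
  have h1 : S ≤ 1 / κ ↔ κ * S ≤ 1 / 1 := by rw [le_div_iff₀ hκ, mul_comm, div_one]
  have h2 : κ * √(S / κ) = √(κ * S / 1) := by
    have : κ * S / 1 = κ ^ 2 * (S / κ) := by field_simp
    rw [this, Real.sqrt_mul (sq_nonneg κ), Real.sqrt_sq hκ.le]
  unfold bestResponse
  simp only [mul_eq_zero, hκ.ne', false_or, h1]
  split_ifs
  · rfl
  · rw [mul_sub, h2]
  · simp

theorem mul_update (κ : ℝ) (x : Fin n → ℝ) (i : Fin n) (z : ℝ) :
    (fun k => κ * Function.update x i z k) = Function.update (fun k => κ * x k) i (κ * z) := by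
  funext k
  by_cases h : k = i
  · subst h; simp
  · simp [h]

theorem bestResponse_nonneg {κ a S : ℝ} (hκ : 0 < κ) (ha : 0 ≤ a) (hS : 0 ≤ S) :
    0 ≤ bestResponse κ a S := by
  unfold bestResponse
  split_ifs with h1 h2
  · exact ha
  · rw [sub_nonneg]
    refine Real.le_sqrt_of_sq_le ?_
    rw [le_div_iff₀ hκ] at *
    nlinarith
  · exact le_rfl

theorem othersOutput_nonneg {x : Fin n → ℝ} (hx : ∀ k, 0 ≤ x k) (i : Fin n) :
    0 ≤ othersOutput x i := sum_nonneg fun k _ => hx k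

theorem step_nonneg {κ a : ℝ} (hκ : 0 < κ) (ha : 0 ≤ a) {x : Fin n → ℝ} (hx : ∀ k, 0 ≤ x k)
    (i k : Fin n) : 0 ≤ step κ a x i k := by
  unfold step
  by_cases h : k = i
  · subst h
    simpa using bestResponse_nonneg hκ ha (othersOutput_nonneg hx k)
  · simpa [h] using hx k

/-- Measuring outputs in units of `1 / κ` turns the dynamics with unit cost `κ` into the one with
unit cost `1`. -/
theorem mul_profile {κ : ℝ} (hκ : 0 < κ) (a : ℝ) (x₀ : Fin n → ℝ)
    (ω : ℕ → Fin n) (t : ℕ) :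
    (fun k => κ * profile κ a x₀ ω t k) = profile 1 (κ * a) (fun k => κ * x₀ k) ω t := by
  induction t with
  | zero => rfl
  | succ t ih =>
    rw [profile_succ, profile_succ, ← ih]
    unfold step
    rw [mul_update, othersOutput_mul,
      mul_bestResponse hκ]

theorem utility_mul {κ : ℝ} (hκ : 0 < κ) (i : Fin n) (x : Fin n → ℝ) :
    utility 1 i (fun k => κ * x k) = utility κ i x := by
  unfold utility
  rw [← mul_sum, mul_div_mul_left _ _ hκ.ne', one_mul]
  simp only [mul_eq_zero, hκ.ne', false_or]

theorem isApproxEquilibrium_mul {κ : ℝ} (hκ : 0 < κ) (ε : ℝ) (x : Fin n → ℝ) :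
    IsApproxEquilibrium 1 ε (fun k => κ * x k) ↔ IsApproxEquilibrium κ ε x := by
  unfold IsApproxEquilibrium
  simp only [utility_mul hκ]
  refine forall_congr' fun i => ⟨fun h z hz => ?_, fun h z hz => ?_⟩
  · have := h (κ * z) (mul_nonneg hκ.le hz)
    rwa [← mul_update, utility_mul hκ] at this
  · have := h (z / κ) (div_nonneg hz hκ.le)
    rwa [← utility_mul hκ, mul_update, mul_div_cancel₀ _ hκ.ne'] at this

theorem startParam_mul (κ a : ℝ) (x₀ : Fin n → ℝ) :
    startParam 1 (κ * a) (fun k => κ * x₀ k) = startParam κ a x₀ := by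
  simp [startParam, smallOutputs]

end Scaling

section Move

variable {n : ℕ}

/-- Aggregate output of a profile. -/
def total (x : Fin n → ℝ) : ℝ := ∑ k, x k

theorem othersOutput_eq (x : Fin n → ℝ) (i : Fin n) : othersOutput x i = total x - x i := by
  rw [othersOutput, total, ← add_sum_erase univ x (mem_univ i)]
  ring

theorem le_othersOutput {x : Fin n → ℝ} (hx : ∀ k, 0 ≤ x k) {i k : Fin n} (h : k ≠ i) :
    x k ≤ othersOutput x i :=
  single_le_sum (f := x) (fun k _ => hx k) (mem_erase.2 ⟨h, mem_univ k⟩)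

theorem add_le_total {x : Fin n → ℝ} (hx : ∀ k, 0 ≤ x k) {i k : Fin n} (h : k ≠ i) :
    x k + x i ≤ total x := by
  linarith [le_othersOutput hx h, othersOutput_eq x i]

theorem add_add_le_total {x : Fin n → ℝ} (hx : ∀ k, 0 ≤ x k) {i j k : Fin n} (hij : i ≠ j)
    (hik : i ≠ k) (hjk : j ≠ k) : x i + x j + x k ≤ total x := by
  have h := sum_le_univ_sum_of_nonneg (s := {i, j, k}) (f := x) hx
  rw [sum_insert (by simp [hij, hik]), sum_insert (by simp [hjk]), sum_singleton] at h
  rw [total]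
  linarith

theorem total_nonneg {x : Fin n → ℝ} (hx : ∀ k, 0 ≤ x k) : 0 ≤ total x :=
  sum_nonneg fun k _ => hx k

theorem bestResponse_zero (κ a : ℝ) : bestResponse κ a 0 = a := by simp [bestResponse]

theorem bestResponse_of_le_one (a : ℝ) {S : ℝ} (h0 : 0 < S) (h1 : S ≤ 1) :
    bestResponse 1 a S = √S - S := by simp [bestResponse, h0.ne', h1]

theorem bestResponse_of_one_le (a : ℝ) {S : ℝ} (h : 1 ≤ S) : bestResponse 1 a S = 0 := by
  rcases h.eq_or_lt with rfl | h
  · simp [bestResponse]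
  · simp [bestResponse, h.not_ge, (zero_lt_one.trans h).ne']

theorem bestResponse_le {a S : ℝ} (ha : a < 1 / 4) (hS : 0 ≤ S) :
    bestResponse 1 a S ≤ 1 / 4 := by
  rcases hS.eq_or_lt with rfl | h0
  · rw [bestResponse_zero]
    exact ha.le
  rcases le_total S 1 with h1 | h1
  · rw [bestResponse_of_le_one a h0 h1]
    nlinarith [Real.sq_sqrt hS, sq_nonneg (√S - 1 / 2)]
  · rw [bestResponse_of_one_le a h1]
    norm_num

@[simp] theorem step_self (κ a : ℝ) (x : Fin n → ℝ) (i : Fin n) :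
    step κ a x i i = bestResponse κ a (othersOutput x i) := by simp [step]

theorem step_of_ne (κ a : ℝ) (x : Fin n → ℝ) {i k : Fin n} (h : k ≠ i) :
    step κ a x i k = x k := by simp [step, h]

theorem othersOutput_step (κ a : ℝ) (x : Fin n → ℝ) (i : Fin n) :
    othersOutput (step κ a x i) i = othersOutput x i :=
  sum_congr rfl fun _ hk => step_of_ne κ a x (ne_of_mem_erase hk)

theorem total_step (κ a : ℝ) (x : Fin n → ℝ) (i : Fin n) :
    total (step κ a x i) = othersOutput x i + bestResponse κ a (othersOutput x i) := by
  have h := othersOutput_eq (step κ a x i) i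
  rw [othersOutput_step, step_self] at h
  linarith

theorem total_step_of_le_one (a : ℝ) {x : Fin n → ℝ} {i : Fin n} (h0 : 0 < othersOutput x i)
    (h1 : othersOutput x i ≤ 1) : total (step 1 a x i) = √(othersOutput x i) := by
  rw [total_step, bestResponse_of_le_one a h0 h1]
  ring

theorem total_step_of_one_le (a : ℝ) {x : Fin n → ℝ} {i : Fin n} (h1 : 1 ≤ othersOutput x i) :
    total (step 1 a x i) = othersOutput x i := by
  rw [total_step, bestResponse_of_one_le a h1, add_zero]

theorem total_step_of_eq_zero (a : ℝ) {x : Fin n → ℝ} {i : Fin n} (h : othersOutput x i = 0) :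
    total (step 1 a x i) = a := by
  rw [total_step, h, bestResponse_zero, zero_add]

/-- A move that leaves the aggregate output above `1` started above `1`, and the mover quits. -/
theorem one_lt_of_one_lt_total_step {a : ℝ} (ha : a < 1 / 4) {x : Fin n → ℝ} (hx : ∀ k, 0 ≤ x k)
    {i : Fin n} (h : 1 < total (step 1 a x i)) : 1 < othersOutput x i := by
  by_contra! h1
  rcases (othersOutput_nonneg hx i).eq_or_lt with h0 | h0
  · rw [total_step_of_eq_zero a h0.symm] at h
    linarith
  · rw [total_step_of_le_one a h0 h1] at h
    exact absurd (Real.sqrt_le_one.2 h1) h.not_ge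

theorem total_step_le_one {a : ℝ} (ha : a < 1 / 4) {x : Fin n → ℝ} (hx : ∀ k, 0 ≤ x k)
    (i : Fin n) (h : total x ≤ 1) : total (step 1 a x i) ≤ 1 := by
  by_contra! h1
  linarith [one_lt_of_one_lt_total_step ha hx h1, othersOutput_eq x i, hx i]

/-- Against opponents with positive aggregate output `S`, the utility falls short of the optimal
value `(1 - √S) ^ 2` by `(s - √S) ^ 2 / s`, where `s` is the total output. -/
theorem utility_eq {x : Fin n → ℝ} (hx : ∀ k, 0 ≤ x k) {i : Fin n} (h0 : 0 < othersOutput x i) :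
    utility 1 i x = (1 - √(othersOutput x i)) ^ 2
      - (total x - √(othersOutput x i)) ^ 2 / total x := by
  have h1 := othersOutput_eq x i
  have h2 : 0 < total x := by linarith [hx i]
  have h3 := Real.sq_sqrt h0.le
  have hxi : x i = total x - √(othersOutput x i) ^ 2 := by rw [h3]; linarith
  have hu : utility 1 i x = x i / total x - x i := by
    unfold utility
    rw [← total, if_neg h2.ne', one_mul]
  rw [hu, hxi]
  field_simp
  ring

/-- Approximate equilibria as profiles in which every agent has a small relative loss. -/
theorem isApproxEquilibrium_iff {ε : ℝ} (hε : ε < 1) {x : Fin n → ℝ} (hx : ∀ k, 0 ≤ x k)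
    (h0 : ∀ i, 0 < othersOutput x i) (h1 : ∀ i, othersOutput x i ≤ 1) :
    IsApproxEquilibrium 1 ε x ↔ ∀ i, (total x - √(othersOutput x i)) ^ 2 / total x
      ≤ ε * (1 - √(othersOutput x i)) ^ 2 := by
  have key : ∀ i z, 0 ≤ z →
      (∀ k, 0 ≤ Function.update x i z k) ∧
      othersOutput (Function.update x i z) i = othersOutput x i := by
    intro i z hz
    refine ⟨fun k => ?_, ?_⟩
    · by_cases h : k = i
      · subst h; simpa using hz
      · simpa [h] using hx k
    · exact sum_congr rfl fun k hk => by simp [ne_of_mem_erase hk]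
  refine forall_congr' fun i => ⟨fun h => ?_, fun h z hz => ?_⟩
  · set S := othersOutput x i with hS
    have hz : 0 ≤ √S - S := by
      rw [sub_nonneg]
      exact Real.le_sqrt_of_sq_le (by nlinarith [h0 i, h1 i])
    obtain ⟨k1, k2⟩ := key i _ hz
    have hu := h _ hz
    have ht : total (Function.update x i (√S - S)) = √S := by
      have := othersOutput_eq (Function.update x i (√S - S)) i
      rw [k2, Function.update_self] at this
      linarith
    rw [utility_eq k1 (by rw [k2]; exact h0 i), utility_eq hx (h0 i), k2, ht, ← hS] at hu
    simp only [sub_self, ne_eq, OfNat.ofNat_ne_zero, not_false_eq_true, zero_pow, zero_div,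
      sub_zero] at hu
    linarith
  · obtain ⟨k1, k2⟩ := key i z hz
    rw [utility_eq k1 (by rw [k2]; exact h0 i), utility_eq hx (h0 i), k2]
    have : 0 ≤ (1 - ε) * ((total (Function.update x i z) - √(othersOutput x i)) ^ 2
        / total (Function.update x i z)) :=
      mul_nonneg (by linarith) (div_nonneg (sq_nonneg _) (total_nonneg k1))
    linarith

end Move

/-! ### Reachable profiles and growth of the total output -/

section Reachable

variable {n : ℕ}

/-- Quantitative non-degeneracy of a profile, preserved by every move: aggregate outputs of
opponents vanish or are at least `γ ^ 2`. The last two conditions control agents that have not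
moved yet: an output slightly below `1` would let the others respond with almost nothing. -/
structure Admissible (γ : ℝ) (x : Fin n → ℝ) : Prop where
  nonneg : ∀ k, 0 ≤ x k
  others : ∀ i, othersOutput x i = 0 ∨ γ ^ 2 ≤ othersOutput x i
  gap : ∀ i, x i ≤ 1 / 4 ∨ 1 ≤ x i ∨ 2 * γ ^ 2 ≤ 1 - √(x i)
  large : ∀ i k, i ≠ k → 1 ≤ x i → x k = 0 ∨ γ ^ 2 ≤ x k

variable {γ a : ℝ} {x : Fin n → ℝ}

theorem Admissible.step (hγ : 0 < γ) (hγa : γ ≤ a) (ha : a < 1 / 4) (hx : Admissible γ x)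
    (j : Fin n) : Admissible γ (step 1 a x j) := by
  have ha0 : 0 ≤ a := hγ.le.trans hγa
  have hγ4 : γ < 1 / 4 := hγa.trans_lt ha
  have hnn := step_nonneg (x := x) one_pos ha0 hx.nonneg j
  have hle : LotteryContest.step 1 a x j j ≤ 1 / 4 := by
    rw [step_self]
    exact bestResponse_le ha (othersOutput_nonneg hx.nonneg j)
  have hlarge : ∀ i k, i ≠ k → 1 ≤ LotteryContest.step 1 a x j i →
      LotteryContest.step 1 a x j k = 0 ∨ γ ^ 2 ≤ LotteryContest.step 1 a x j k := by
    intro i k hik h1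
    have hij : i ≠ j := by
      rintro rfl
      linarith
    rw [step_of_ne _ _ _ hij] at h1
    by_cases hkj : k = j
    · subst hkj
      left
      rw [step_self]
      exact bestResponse_of_one_le a (h1.trans (le_othersOutput hx.nonneg hij))
    · rw [step_of_ne _ _ _ hkj]
      exact hx.large i k hik h1
  refine ⟨hnn, fun i => ?_, fun i => ?_, hlarge⟩
  · by_cases hij : i = j
    · subst hij
      rw [othersOutput_step]
      exact hx.others i
    have hxi : x i ≤ othersOutput x j := le_othersOutput hx.nonneg hij
    have hxi0 := hx.nonneg i
    have hSi : othersOutput (LotteryContest.step 1 a x j) i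
        = total (LotteryContest.step 1 a x j) - x i := by
      rw [othersOutput_eq, step_of_ne _ _ _ hij]
    rcases (othersOutput_nonneg hx.nonneg j).eq_or_lt with h0 | h0
    · right
      rw [hSi, total_step_of_eq_zero a h0.symm]
      nlinarith
    have hS : γ ^ 2 ≤ othersOutput x j := (hx.others j).resolve_left h0.ne'
    rcases le_total (othersOutput x j) 1 with h1 | h1
    · rw [hSi, total_step_of_le_one a h0 h1]
      set r := √(othersOutput x j) with hr
      have hr2 : r ^ 2 = othersOutput x j := Real.sq_sqrt h0.le
      have hr0 : 0 ≤ r := Real.sqrt_nonneg _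
      have hr1 : r ≤ 1 := Real.sqrt_le_one.2 h1
      have hrγ : γ ≤ r := Real.le_sqrt_of_sq_le hS
      by_cases hq : x i ≤ 1 / 4
      · right
        rcases le_total (1 / 2) r with h | h <;> nlinarith
      rcases hx.gap i with h | h | h
      · exact absurd h hq
      · left
        nlinarith
      · right
        have hq2 : √(x i) ^ 2 = x i := Real.sq_sqrt hxi0
        have hq3 : 1 / 2 ≤ √(x i) := Real.le_sqrt_of_sq_le (by linarith)
        have hqr : √(x i) ≤ r := Real.sqrt_le_sqrt hxi
        nlinarith
    · have hbr := bestResponse_of_one_le a h1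
      rcases hx.gap i with h | h | h
      · right
        rw [hSi, total_step_of_one_le a h1]
        nlinarith
      · by_cases hz : ∃ k, k ≠ i ∧ LotteryContest.step 1 a x j k ≠ 0
        · obtain ⟨k, hki, hk⟩ := hz
          right
          have h2 := (hlarge i k hki.symm (by rwa [step_of_ne _ _ _ hij])).resolve_left hk
          exact h2.trans (le_othersOutput hnn hki)
        · push Not at hz
          left
          exact sum_eq_zero fun k hk => hz k (ne_of_mem_erase hk)
      · right
        rw [hSi, total_step_of_one_le a h1]
        have hq2 : √(x i) ^ 2 = x i := Real.sq_sqrt hxi0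
        nlinarith [Real.sqrt_nonneg (x i)]
  · by_cases hij : i = j
    · subst hij
      exact Or.inl hle
    · rw [step_of_ne _ _ _ hij]
      exact hx.gap i

theorem Admissible.le_total_step (hγ : 0 < γ) (hγa : γ ≤ a) (ha : a < 1 / 4)
    (hx : Admissible γ x) (j : Fin n) : γ ≤ total (LotteryContest.step 1 a x j) := by
  rcases (othersOutput_nonneg hx.nonneg j).eq_or_lt with h0 | h0
  · rwa [total_step_of_eq_zero a h0.symm]
  rcases le_total (othersOutput x j) 1 with h1 | h1
  · rw [total_step_of_le_one a h0 h1]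
    exact Real.le_sqrt_of_sq_le ((hx.others j).resolve_left h0.ne')
  · rw [total_step_of_one_le a h1]
    linarith

/-- Some agent plays a best response: after the move of `j` to a total `s ≤ 1`, her output is
`s - s ^ 2`, or all of `s = a` if the others produced nothing. -/
def HasResponder (a : ℝ) (x : Fin n → ℝ) : Prop :=
  ∃ j, x j = total x - total x ^ 2 ∨ x j = total x ∧ total x = a

theorem hasResponder_step (hx : ∀ k, 0 ≤ x k) (j : Fin n) :
    1 < total (step 1 a x j) ∨ HasResponder a (step 1 a x j) := by
  rcases (othersOutput_nonneg hx j).eq_or_lt with h0 | h0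
  · right
    refine ⟨j, Or.inr ?_⟩
    rw [total_step_of_eq_zero a h0.symm, step_self, ← h0, bestResponse_zero]
    exact ⟨rfl, rfl⟩
  rcases le_or_gt (othersOutput x j) 1 with h1 | h1
  · right
    refine ⟨j, Or.inl ?_⟩
    rw [total_step_of_le_one a h0 h1, step_self, bestResponse_of_le_one a h0 h1,
      Real.sq_sqrt h0.le]
  · left
    rwa [total_step_of_one_le a h1.le]

/-- Admissible profiles as they occur after at least one move. -/
structure Moved (γ a : ℝ) (x : Fin n → ℝ) : Prop extends Admissible γ x where
  le_total : γ ≤ total x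
  responder : 1 < total x ∨ HasResponder a x

theorem Admissible.moved_step (hγ : 0 < γ) (hγa : γ ≤ a) (ha : a < 1 / 4)
    (hx : Admissible γ x) (j : Fin n) : Moved γ a (LotteryContest.step 1 a x j) :=
  ⟨hx.step hγ hγa ha j, hx.le_total_step hγ hγa ha j, hasResponder_step hx.nonneg j⟩

/-- Profiles in which no output exceeds `1 / 4`, the largest best response, and the total output
is at most `1`. -/
structure Settled (γ a : ℝ) (x : Fin n → ℝ) : Prop extends Moved γ a x where
  le_quarter : ∀ k, x k ≤ 1 / 4
  total_le : total x ≤ 1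

theorem step_le_quarter (ha : a < 1 / 4) (hx : ∀ k, 0 ≤ x k) (h : ∀ k, x k ≤ 1 / 4)
    (j k : Fin n) : step 1 a x j k ≤ 1 / 4 := by
  by_cases hkj : k = j
  · subst hkj
    rw [step_self]
    exact bestResponse_le ha (othersOutput_nonneg hx k)
  · rw [step_of_ne _ _ _ hkj]
    exact h k

theorem Settled.step (hγ : 0 < γ) (hγa : γ ≤ a) (ha : a < 1 / 4) (hx : Settled γ a x)
    (j : Fin n) : Settled γ a (LotteryContest.step 1 a x j) :=
  ⟨hx.moved_step hγ hγa ha j, step_le_quarter ha hx.nonneg hx.le_quarter j,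
    total_step_le_one ha hx.nonneg j hx.total_le⟩

end Reachable

section Settling

variable {n : ℕ} {a : ℝ} {x : Fin n → ℝ}

/-- The contribution of agent `k` to the number of obstructions to being settled. -/
noncomputable def obstruction (x : Fin n → ℝ) (k : Fin n) : ℝ :=
  (if 1 / 4 < x k then 1 else 0) + (if 1 < total x ∧ 0 < x k then 1 else 0)

theorem obstruction_nonneg (x : Fin n → ℝ) (k : Fin n) : 0 ≤ obstruction x k := by
  unfold obstruction
  split_ifs <;> norm_num

theorem obstruction_le (x : Fin n → ℝ) (k : Fin n) : obstruction x k ≤ 2 := by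
  unfold obstruction
  split_ifs <;> norm_num

theorem sum_obstruction_le (x : Fin n → ℝ) : ∑ k, obstruction x k ≤ 2 * n := by
  calc ∑ k, obstruction x k ≤ ∑ _k : Fin n, (2 : ℝ) := sum_le_sum fun k _ => obstruction_le x k
    _ = 2 * n := by simp [mul_comm]

theorem obstruction_step_self (ha : a < 1 / 4) (hx : ∀ k, 0 ≤ x k) (i : Fin n) :
    obstruction (step 1 a x i) i = 0 := by
  have h1 : ¬ 1 / 4 < step 1 a x i i := by
    rw [step_self, not_lt]
    exact bestResponse_le ha (othersOutput_nonneg hx i)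
  have h2 : ¬ (1 < total (step 1 a x i) ∧ 0 < step 1 a x i i) := by
    rintro ⟨h3, h4⟩
    rw [step_self, bestResponse_of_one_le a (one_lt_of_one_lt_total_step ha hx h3).le] at h4
    exact h4.false
  simp only [obstruction, if_neg h1, if_neg h2, add_zero]

theorem obstruction_step_le (ha : a < 1 / 4) (hx : ∀ k, 0 ≤ x k) {i k : Fin n} (hk : k ≠ i) :
    obstruction (step 1 a x i) k ≤ obstruction x k := by
  unfold obstruction
  rw [step_of_ne _ _ _ hk]
  refine add_le_add le_rfl ?_
  by_cases h : 1 < total (step 1 a x i) ∧ 0 < x k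
  · have : 1 < total x := by
      linarith [one_lt_of_one_lt_total_step ha hx h.1, othersOutput_eq x i, hx i]
    rw [if_pos h, if_pos ⟨this, h.2⟩]
  · rw [if_neg h]
    split_ifs <;> norm_num

theorem avg_obstruction_le [NeZero n] (ha : a < 1 / 4) (hx : ∀ k, 0 ≤ x k) :
    avg (step 1 a) (fun y => ∑ k, obstruction y k) x
      ≤ (1 - 1 / n) * ∑ k, obstruction x k := by
  have hn : (0 : ℝ) < n := Nat.cast_pos.2 (NeZero.pos n)
  have h : ∀ i, ∑ k, obstruction (step 1 a x i) k ≤ ∑ k, obstruction x k - obstruction x i := by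
    intro i
    rw [← add_sum_erase univ _ (mem_univ i), obstruction_step_self ha hx,
      ← add_sum_erase univ (obstruction x) (mem_univ i), zero_add, add_sub_cancel_left]
    exact sum_le_sum fun k hk => obstruction_step_le ha hx (ne_of_mem_erase hk)
  have h2 := sum_le_sum fun i (_ : i ∈ univ) => h i
  rw [sum_sub_distrib, sum_const, card_univ, Fintype.card_fin, nsmul_eq_mul] at h2
  unfold avg
  rw [div_le_iff₀ hn]
  calc _ ≤ _ := h2
    _ = _ := by field_simp

theorem one_le_sum_obstruction (h : ¬ ((∀ k, x k ≤ 1 / 4) ∧ total x ≤ 1)) :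
    1 ≤ ∑ k, obstruction x k := by
  have key : ∃ k, 1 ≤ obstruction x k := by
    by_contra! hk
    refine h ⟨fun k => ?_, ?_⟩
    · by_contra! h1
      refine absurd (hk k) (not_lt.2 ?_)
      unfold obstruction
      rw [if_pos h1]
      split_ifs <;> norm_num
    · by_contra! h1
      obtain ⟨k, -, h2⟩ := exists_lt_of_sum_lt (s := univ) (f := fun _ => (0 : ℝ)) (g := x)
        (by rw [sum_const_zero]; exact zero_lt_one.trans h1)
      refine absurd (hk k) (not_lt.2 ?_)
      unfold obstruction
      rw [if_pos (⟨h1, h2⟩ : 1 < total x ∧ 0 < x k)]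
      split_ifs <;> norm_num
  obtain ⟨k, hk⟩ := key
  exact hk.trans (single_le_sum (f := obstruction x) (fun k _ => obstruction_nonneg x k)
    (mem_univ k))

end Settling

section Growth

variable {n : ℕ} {γ a : ℝ} {x : Fin n → ℝ}

/-- The logarithmic deficit of the total output `s`, measured from `3 / 4` and set to `0` once
`s ≥ 1 / 2`. -/
noncomputable def deficit (x : Fin n → ℝ) : ℝ :=
  if total x < 1 / 2 then Real.log (3 / (4 * total x)) else 0

theorem deficit_nonneg (h : 0 < total x) : 0 ≤ deficit x := by
  unfold deficit
  split_ifs with h1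
  · refine Real.log_nonneg ?_
    rw [le_div_iff₀ (by positivity)]
    linarith
  · exact le_rfl

theorem deficit_le_of_le {y : Fin n → ℝ} (h0 : 0 < total x) (h : total x ≤ total y) :
    deficit y ≤ deficit x := by
  have := deficit_nonneg h0
  unfold deficit at *
  by_cases hy : total y < 1 / 2
  · rw [if_pos hy, if_pos (h.trans_lt hy)]
    refine Real.log_le_log (by have := h0.trans_le h; positivity) ?_
    exact div_le_div_of_nonneg_left (by norm_num) (by positivity) (by linarith)
  · rwa [if_neg hy]

theorem deficit_le_half {y : Fin n → ℝ} (h0 : 0 < total x) (h : total x ≤ total y)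
    (h2 : 3 / 4 * total x ≤ total y ^ 2) : deficit y ≤ deficit x / 2 := by
  have := deficit_nonneg h0
  have hy0 := h0.trans_le h
  unfold deficit at *
  by_cases hy : total y < 1 / 2
  · rw [if_pos hy, if_pos (h.trans_lt hy), le_div_iff₀ two_pos, mul_comm, ← Nat.cast_two,
      ← Real.log_pow]
    refine Real.log_le_log (by positivity) ?_
    rw [div_pow, div_le_div_iff₀ (by positivity) (by positivity)]
    nlinarith
  · rw [if_neg hy]
    linarith

theorem le_responder {j : Fin n}
    (hj : x j = total x - total x ^ 2 ∨ x j = total x ∧ total x = a) :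
    total x - total x ^ 2 ≤ x j := by
  rcases hj with h | h
  · exact h.ge
  · nlinarith

theorem half_le_total_step (h : ∀ k, x k ≤ 1 / 4) (hs : 1 / 2 ≤ total x) (h1 : total x ≤ 1)
    (hx : ∀ k, 0 ≤ x k) (i : Fin n) : 1 / 2 ≤ total (step 1 a x i) := by
  have hS := othersOutput_eq x i
  have := h i
  have := hx i
  rw [total_step_of_le_one a (by linarith) (by linarith)]
  exact Real.le_sqrt_of_sq_le (by linarith)

theorem total_step_of_responder (hγ : 0 < γ) (hx : Settled γ a x)
    {j : Fin n} (hj : x j = total x - total x ^ 2 ∨ x j = total x ∧ total x = a) :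
    total (step 1 a x j) = total x := by
  have h0 : 0 < total x := hγ.trans_le hx.le_total
  have hS := othersOutput_eq x j
  rcases hj with h | ⟨h, h'⟩
  · rw [h, sub_sub_cancel] at hS
    rw [total_step_of_le_one a (by rw [hS]; positivity)
      (by rw [hS]; exact pow_le_one₀ h0.le hx.total_le), hS, Real.sqrt_sq h0.le]
  · rw [total_step_of_eq_zero a (by rw [hS, h, sub_self]), h']

theorem total_step_sq (hγ : 0 < γ) (hx : Settled γ a x) (hs : total x < 1 / 2)
    {i j : Fin n} (hij : i ≠ j)
    (hj : x j = total x - total x ^ 2 ∨ x j = total x ∧ total x = a) :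
    total (step 1 a x i) ^ 2 = total x - x i := by
  have h0 : 0 < total x := hγ.trans_le hx.le_total
  have hS := othersOutput_eq x i
  have h1 := le_responder hj
  have h2 := add_le_total hx.nonneg hij
  have h3 := hx.nonneg i
  rw [total_step_of_le_one a (by nlinarith) (by linarith), Real.sq_sqrt (by nlinarith), hS]

theorem total_le_total_step (hγ : 0 < γ) (hx : Settled γ a x) (hs : total x < 1 / 2)
    (i : Fin n) : total x ≤ total (step 1 a x i) := by
  have h0 : 0 < total x := hγ.trans_le hx.le_total
  obtain ⟨j, hj⟩ := hx.responder.resolve_left hx.total_le.not_gt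
  by_cases hij : i = j
  · subst hij
    exact (total_step_of_responder hγ hx hj).ge
  · have h1 := le_responder hj
    have h2 := add_le_total hx.nonneg hij
    have h3 := total_step_sq hγ hx hs hij hj
    have h4 : 0 ≤ total (step 1 a x i) := by
      rw [total_step_of_le_one a (by nlinarith [othersOutput_eq x i])
        (by linarith [othersOutput_eq x i, hx.nonneg i])]
      exact Real.sqrt_nonneg _
    refine abs_le_of_sq_le_sq' ?_ h4 |>.2
    nlinarith

/-- At least a third of the agents are neither the last mover nor hold most of the output left by
the last mover; any of them halves the deficit. -/
theorem exists_halving (hn : 3 ≤ n) (hγ : 0 < γ) (hx : Settled γ a x) (hs : total x < 1 / 2) :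
    ∃ G : Finset (Fin n), (n : ℝ) / 3 ≤ G.card ∧
      ∀ i ∈ G, deficit (step 1 a x i) ≤ deficit x / 2 := by
  classical
  have h0 : 0 < total x := hγ.trans_le hx.le_total
  obtain ⟨j, hj⟩ := hx.responder.resolve_left hx.total_le.not_gt
  have h1 := le_responder hj
  set G : Finset (Fin n) := univ.filter fun i => i ≠ j ∧ x i ≤ total x ^ 2 / 2 with hG
  refine ⟨G, ?_, fun i hi => ?_⟩
  · set H : Finset (Fin n) := univ.filter fun i => i ≠ j ∧ total x ^ 2 / 2 < x i with hH
    have hHc : H.card ≤ 1 := by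
      rw [card_le_one]
      intro p hp q hq
      simp only [hH, mem_filter, mem_univ, true_and] at hp hq
      by_contra hpq
      have := add_add_le_total hx.nonneg hpq hp.1 hq.1
      linarith [hp.2, hq.2]
    have hcov : (univ : Finset (Fin n)) ⊆ insert j (G ∪ H) := by
      intro i _
      by_cases hij : i = j
      · simp [hij]
      · rcases le_or_gt (x i) (total x ^ 2 / 2) with h | h <;> simp [hG, hH, hij, h]
    have hc := card_le_card hcov
    rw [card_univ, Fintype.card_fin] at hc
    have hc2 := card_insert_le j (G ∪ H)
    have hc3 := card_union_le G H
    have h3 : n ≤ G.card + 2 := by omega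
    have h4 : (n : ℝ) ≤ G.card + 2 := by exact_mod_cast h3
    have h5 : (3 : ℝ) ≤ n := by exact_mod_cast hn
    linarith
  · simp only [hG, mem_filter, mem_univ, true_and] at hi
    refine deficit_le_half h0 (total_le_total_step hγ hx hs i) ?_
    rw [total_step_sq hγ hx hs hi.1 hj]
    nlinarith [hi.2]

theorem avg_deficit_le [NeZero n] (hn : 3 ≤ n) (hγ : 0 < γ) (hx : Settled γ a x) :
    avg (step 1 a) deficit x ≤ (1 - 1 / 6) * deficit x := by
  have hn0 : (0 : ℝ) < n := Nat.cast_pos.2 (NeZero.pos n)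
  have h0 : 0 < total x := hγ.trans_le hx.le_total
  unfold avg
  rw [div_le_iff₀ hn0]
  by_cases hs : total x < 1 / 2
  · obtain ⟨G, hG, hhalf⟩ := exists_halving hn hγ hx hs
    have hd := deficit_nonneg h0
    calc ∑ i, deficit (step 1 a x i)
        ≤ ∑ i, (deficit x - if i ∈ G then deficit x / 2 else 0) := by
          refine sum_le_sum fun i _ => ?_
          split_ifs with h
          · linarith [hhalf i h]
          · rw [sub_zero]
            exact deficit_le_of_le h0 (total_le_total_step hγ hx hs i)
      _ = n * deficit x - G.card * (deficit x / 2) := by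
          rw [sum_sub_distrib, sum_ite_mem]
          simp
      _ ≤ (1 - 1 / 6) * deficit x * n := by nlinarith
  · have h1 : ∀ i, deficit (step 1 a x i) = 0 := fun i => by
      rw [deficit, if_neg (not_lt.2 (half_le_total_step hx.le_quarter (not_lt.1 hs) hx.total_le
        hx.nonneg i))]
    have h2 : deficit x = 0 := if_neg hs
    simp [h1, h2]

end Growth

/-! ### The potential and its strong convexity -/

section Potential

variable {n : ℕ} {a : ℝ} {x : Fin n → ℝ}

/-- An exact best-response potential of the contest with unit cost `1`: its partial derivative
in direction `i` is `x i - s + s ^ 2`, which vanishes exactly at a best response of agent `i`. -/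
noncomputable def potential (x : Fin n → ℝ) : ℝ :=
  (∑ k, x k ^ 2) / 2 - total x ^ 2 / 2 + total x ^ 3 / 3

/-- The total output `(n - 1) / n` of the Nash equilibrium with unit cost `1`. -/
noncomputable def eqTotal (n : ℕ) : ℝ := 1 - 1 / n

/-- The output `(n - 1) / n ^ 2` of every agent in the Nash equilibrium with unit cost `1`. -/
noncomputable def eqOutput (n : ℕ) : ℝ := eqTotal n / n

theorem natCast_mul_eqOutput [NeZero n] : n * eqOutput n = eqTotal n := by
  have : (n : ℝ) ≠ 0 := Nat.cast_ne_zero.2 (NeZero.ne n)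
  unfold eqOutput
  field_simp

theorem eqOutput_eq [NeZero n] : eqOutput n = eqTotal n - eqTotal n ^ 2 := by
  have : (n : ℝ) ≠ 0 := Nat.cast_ne_zero.2 (NeZero.ne n)
  unfold eqOutput eqTotal
  field_simp
  ring

theorem two_thirds_le_eqTotal (hn : 3 ≤ n) : 2 / 3 ≤ eqTotal n := by
  have h : (3 : ℝ) ≤ n := by exact_mod_cast hn
  have : (1 : ℝ) / n ≤ 1 / 3 := one_div_le_one_div_of_le (by norm_num) h
  unfold eqTotal
  linarith

theorem eqTotal_le_one (n : ℕ) : eqTotal n ≤ 1 := by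
  have : (0 : ℝ) ≤ 1 / n := by positivity
  unfold eqTotal
  linarith

/-- The excess of the potential over its value at the equilibrium. -/
noncomputable def excess (x : Fin n → ℝ) : ℝ :=
  potential x - potential fun _ : Fin n => eqOutput n

theorem potential_eqOutput [NeZero n] : potential (fun _ : Fin n => eqOutput n)
    = eqTotal n * eqOutput n / 2 - eqTotal n ^ 2 / 2 + eqTotal n ^ 3 / 3 := by
  simp only [potential, total, sum_const, card_univ, Fintype.card_fin, nsmul_eq_mul]
  rw [natCast_mul_eqOutput, ← natCast_mul_eqOutput]
  ring

/-- The Polyak–Łojasiewicz inequality: on `s ≥ 1 / 2` the Hessian `1 + (2 s - 1) J` of the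
potential, `J` the all-ones matrix, is at least the identity, so the excess is at most half the
squared norm of the gradient. -/
theorem excess_le_sum_sq [NeZero n] (hn : 3 ≤ n) (hs : 1 / 2 ≤ total x) :
    excess x ≤ (∑ k, (x k - total x + total x ^ 2) ^ 2) / 2 := by
  have hS := two_thirds_le_eqTotal hn
  have h1 : ∑ k, ((x k ^ 2 - eqOutput n ^ 2)
      + 2 * (x k - total x + total x ^ 2) * (eqOutput n - x k)
      + (eqOutput n - x k) ^ 2) = 2 * (total x ^ 2 - total x) * (eqTotal n - total x) := by
    calc _ = ∑ k, 2 * (total x ^ 2 - total x) * (eqOutput n - x k) :=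
          sum_congr rfl fun k _ => by ring
      _ = _ := by
          rw [← mul_sum, sum_sub_distrib, ← natCast_mul_eqOutput]
          simp [total]
  have h2 : ∑ k, (x k ^ 2 - eqOutput n ^ 2) ≤ ∑ k, (x k - total x + total x ^ 2) ^ 2
      + 2 * (total x ^ 2 - total x) * (eqTotal n - total x) := by
    rw [← h1, ← sum_add_distrib]
    refine sum_le_sum fun k _ => ?_
    nlinarith [sq_nonneg (x k - total x + total x ^ 2 + (eqOutput n - x k))]
  have h3 : ∑ k, (x k ^ 2 - eqOutput n ^ 2) = ∑ k, x k ^ 2 - eqTotal n * eqOutput n := by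
    rw [sum_sub_distrib, ← natCast_mul_eqOutput]
    simp
    ring
  have h4 : 0 ≤ (eqTotal n - total x) ^ 2 * ((2 * total x + eqTotal n) / 3 - 1 / 2) :=
    mul_nonneg (sq_nonneg _) (by linarith)
  rw [excess, potential_eqOutput, potential]
  nlinarith

/-- The excess controls the distance of the total output from its equilibrium value. -/
theorem sq_sub_eqTotal_le [NeZero n] (hn : 3 ≤ n) (hs : 1 / 2 ≤ total x) :
    (total x - eqTotal n) ^ 2 ≤ 9 * excess x := by
  have hS := two_thirds_le_eqTotal hn
  have h1 : ∑ k, (x k - eqOutput n) ^ 2 = ∑ k, x k ^ 2 - 2 * eqOutput n * total x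
      + eqTotal n * eqOutput n := by
    rw [← natCast_mul_eqOutput]
    simp only [sub_sq, sum_add_distrib, sum_sub_distrib, sum_const, card_univ, Fintype.card_fin,
      nsmul_eq_mul, total, mul_sum]
    congr 1
    · congr 1
      exact sum_congr rfl fun k _ => by ring
    · ring
  have h2 : 0 ≤ ∑ k, (x k - eqOutput n) ^ 2 := sum_nonneg fun k _ => sq_nonneg _
  have h4 : 0 ≤ (total x - eqTotal n) ^ 2
      * ((2 * eqTotal n + total x) / 3 - 1 / 2 - 1 / 9) :=
    mul_nonneg (sq_nonneg _) (by linarith)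
  rw [h1] at h2
  rw [excess, potential_eqOutput, potential]
  rw [eqOutput_eq] at *
  nlinarith

theorem excess_nonneg [NeZero n] (hn : 3 ≤ n) (hs : 1 / 2 ≤ total x) : 0 ≤ excess x := by
  nlinarith [sq_sub_eqTotal_le hn hs, sq_nonneg (total x - eqTotal n)]

/-- A move to the best response decreases the potential by an explicit amount. -/
theorem excess_sub_excess_step {i : Fin n} (h0 : 0 < othersOutput x i)
    (h1 : othersOutput x i ≤ 1) :
    excess x - excess (step 1 a x i) = (total x - √(othersOutput x i)) ^ 2
      * (total x + 2 * √(othersOutput x i)) / 3 := by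
  have hr : √(othersOutput x i) ^ 2 = othersOutput x i := Real.sq_sqrt h0.le
  have hxi : x i = total x - √(othersOutput x i) ^ 2 := by
    rw [hr, othersOutput_eq]
    ring
  have hsq : ∑ k, step 1 a x i k ^ 2
      = ∑ k, x k ^ 2 - x i ^ 2 + (√(othersOutput x i) - √(othersOutput x i) ^ 2) ^ 2 := by
    rw [← add_sum_erase univ _ (mem_univ i), ← add_sum_erase univ (fun k => x k ^ 2) (mem_univ i),
      step_self, bestResponse_of_le_one a h0 h1, hr,
      sum_congr rfl fun k hk => by rw [step_of_ne 1 a x (ne_of_mem_erase hk)]]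
    ring
  rw [excess, excess, sub_sub_sub_cancel_right, potential, potential, hsq, total_step_of_le_one a h0 h1]
  set r := √(othersOutput x i)
  rw [hxi]
  ring

/-- Profiles near which the potential is strongly convex. -/
structure ConvexRegion (x : Fin n → ℝ) : Prop where
  nonneg : ∀ k, 0 ≤ x k
  le_quarter : ∀ k, x k ≤ 1 / 4
  half_le : 1 / 2 ≤ total x
  total_le : total x ≤ 1

namespace ConvexRegion

theorem quarter_le_othersOutput (hx : ConvexRegion x) (i : Fin n) : 1 / 4 ≤ othersOutput x i := by
  linarith [othersOutput_eq x i, hx.le_quarter i, hx.half_le]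

theorem othersOutput_le_one (hx : ConvexRegion x) (i : Fin n) : othersOutput x i ≤ 1 := by
  linarith [othersOutput_eq x i, hx.nonneg i, hx.total_le]

theorem half_le_sqrt (hx : ConvexRegion x) (i : Fin n) : 1 / 2 ≤ √(othersOutput x i) :=
  Real.le_sqrt_of_sq_le (by linarith [hx.quarter_le_othersOutput i])

theorem step (ha0 : 0 < a) (ha : a < 1 / 4) (hx : ConvexRegion x) (i : Fin n) :
    ConvexRegion (step 1 a x i) :=
  ⟨step_nonneg one_pos ha0.le hx.nonneg i, step_le_quarter ha hx.nonneg hx.le_quarter i,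
    half_le_total_step hx.le_quarter hx.half_le hx.total_le hx.nonneg i,
    total_step_le_one ha hx.nonneg i hx.total_le⟩

theorem excess_sub_excess_step (hx : ConvexRegion x) (i : Fin n) :
    excess x - excess (LotteryContest.step 1 a x i) = (total x - √(othersOutput x i)) ^ 2
      * (total x + 2 * √(othersOutput x i)) / 3 :=
  LotteryContest.excess_sub_excess_step (by linarith [hx.quarter_le_othersOutput i])
    (hx.othersOutput_le_one i)

/-- Exact minimization in a coordinate gains a fixed fraction of the squared partial
derivative. -/
theorem sq_gradient_le (hx : ConvexRegion x) (i : Fin n) :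
    (x i - total x + total x ^ 2) ^ 2 / 6
      ≤ excess x - excess (LotteryContest.step 1 a x i) := by
  rw [hx.excess_sub_excess_step]
  have hr : √(othersOutput x i) ^ 2 = othersOutput x i :=
    Real.sq_sqrt (by linarith [hx.quarter_le_othersOutput i])
  have hr1 : √(othersOutput x i) ≤ 1 := Real.sqrt_le_one.2 (hx.othersOutput_le_one i)
  have hr0 := hx.half_le_sqrt i
  have hg : x i - total x + total x ^ 2 = (total x - √(othersOutput x i))
      * (total x + √(othersOutput x i)) := by
    have := othersOutput_eq x i
    nlinarith
  rw [hg, mul_pow]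
  have := hx.half_le
  have := hx.total_le
  have h2 : (total x + √(othersOutput x i)) ^ 2 ≤ 2 * (total x + 2 * √(othersOutput x i)) := by
    nlinarith
  have := mul_le_mul_of_nonneg_left h2 (sq_nonneg (total x - √(othersOutput x i)))
  linarith

theorem avg_excess_le [NeZero n] (hn : 3 ≤ n) (hx : ConvexRegion x) :
    avg (LotteryContest.step 1 a) excess x ≤ (1 - 1 / (3 * n)) * excess x := by
  have hn0 : (0 : ℝ) < n := Nat.cast_pos.2 (NeZero.pos n)
  have h := sum_le_sum fun i (_ : i ∈ univ) => hx.sq_gradient_le (a := a) i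
  rw [← sum_div, sum_sub_distrib, sum_const, card_univ, Fintype.card_fin, nsmul_eq_mul] at h
  have h2 := excess_le_sum_sq hn hx.half_le
  unfold avg
  rw [div_le_iff₀ hn0]
  calc ∑ i, excess (LotteryContest.step 1 a x i) ≤ n * excess x - excess x / 3 := by linarith
    _ = _ := by field_simp

theorem excess_le [NeZero n] (hn : 3 ≤ n) (hx : ConvexRegion x) : excess x ≤ n / 2 := by
  refine (excess_le_sum_sq hn hx.half_le).trans ?_
  have h : ∀ k, (x k - total x + total x ^ 2) ^ 2 ≤ 1 := by
    intro k
    have h1 := hx.othersOutput_le_one k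
    have h2 := hx.quarter_le_othersOutput k
    have h3 := hx.half_le
    have h4 := hx.total_le
    rw [othersOutput_eq] at h1 h2
    rw [sq_le_one_iff_abs_le_one, abs_le]
    constructor <;> nlinarith
  have := sum_le_sum fun k (_ : k ∈ univ) => h k
  rw [sum_const, card_univ, Fintype.card_fin, nsmul_eq_mul, mul_one] at this
  linarith

/-- Profiles whose potential is nearly minimal are approximate equilibria. -/
theorem isApproxEquilibrium [NeZero n] (hn : 3 ≤ n) (hx : ConvexRegion x) {ε : ℝ} (hε0 : 0 < ε)
    (hε1 : ε < 1) (h : excess x ≤ ε / (144 * n ^ 2)) : IsApproxEquilibrium 1 ε x := by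
  have hn0 : (0 : ℝ) < n := Nat.cast_pos.2 (NeZero.pos n)
  rw [isApproxEquilibrium_iff hε1 hx.nonneg
    (fun i => by linarith [hx.quarter_le_othersOutput i]) hx.othersOutput_le_one]
  intro i
  -- the output played against idle opponents does not matter here, as there are none
  have hd := hx.excess_sub_excess_step (a := 1 / 8) i
  have he := excess_nonneg hn (hx.step (a := 1 / 8) (by norm_num) (by norm_num) i).half_le
  have hS := sq_sub_eqTotal_le hn hx.half_le
  have hr := hx.half_le_sqrt i
  have hs := hx.half_le
  set s := total x
  set r := √(othersOutput x i)
  set p : ℝ := 1 / n with hp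
  have hp0 : 0 < p := by positivity
  have h' : excess x ≤ ε * p ^ 2 / 144 := by
    refine h.trans (le_of_eq ?_)
    rw [hp]
    field_simp
  have hsr : (s - r) ^ 2 ≤ ε * p ^ 2 / 72 := by
    nlinarith [mul_nonneg (sq_nonneg (s - r)) (by linarith : (0 : ℝ) ≤ (s + 2 * r) / 3 - 1 / 2)]
  have hp2 : ε * p ^ 2 ≤ p ^ 2 := by nlinarith [sq_nonneg p]
  have h1 : s - eqTotal n ≤ p / 4 := abs_le_of_sq_le_sq (by nlinarith) (by positivity) |>
    (le_abs_self _).trans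
  have h2 : r - s ≤ p / 4 := abs_le_of_sq_le_sq (by nlinarith) (by positivity) |>
    (le_abs_self _).trans
  have h3 : p / 2 ≤ 1 - r := by
    have : eqTotal n = 1 - p := rfl
    linarith
  rw [div_le_iff₀ (by linarith)]
  have h4 : p ^ 2 / 4 ≤ (1 - r) ^ 2 := by nlinarith
  have h5 : ε * (p ^ 2 / 4) ≤ ε * (1 - r) ^ 2 := mul_le_mul_of_nonneg_left h4 hε0.le
  have h6 : 0 ≤ ε * (1 - r) ^ 2 := by positivity
  nlinarith [sq_nonneg p]

end ConvexRegion

end Potential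

/-! ### The upper bound -/

section StartParam

variable {n : ℕ}

theorem finite_startParam_set (κ a : ℝ) (x : Fin n → ℝ) :
    (smallOutputs κ x ∪ (fun y => √((1 - √y) / 2)) '' smallOutputs κ x ∪ {κ * a}).Finite := by
  have h : (smallOutputs κ x).Finite :=
    (Set.finite_range fun i => κ * x i).subset fun y hy => by
      obtain ⟨i, hi⟩ := hy.2.2
      exact ⟨i, hi.symm⟩
  exact (h.union (h.image _)).union (Set.finite_singleton _)

theorem startParam_mem (κ a : ℝ) (x : Fin n → ℝ) : startParam κ a x ∈
    smallOutputs κ x ∪ (fun y => √((1 - √y) / 2)) '' smallOutputs κ x ∪ {κ * a} :=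
  Set.Nonempty.csInf_mem ⟨κ * a, Or.inr rfl⟩ (finite_startParam_set κ a x)

theorem startParam_le {κ a : ℝ} {x : Fin n → ℝ} {y : ℝ} (hy : y ∈
    smallOutputs κ x ∪ (fun y => √((1 - √y) / 2)) '' smallOutputs κ x ∪ {κ * a}) :
    startParam κ a x ≤ y :=
  csInf_le (finite_startParam_set κ a x).bddBelow hy

theorem startParam_le_self (κ a : ℝ) (x : Fin n → ℝ) : startParam κ a x ≤ κ * a :=
  startParam_le (Or.inr rfl)

theorem startParam_pos {κ a : ℝ} (h : 0 < κ * a) (x : Fin n → ℝ) : 0 < startParam κ a x := by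
  rcases startParam_mem κ a x with (h1 | ⟨y, hy, h1⟩) | h1
  · exact h1.1
  · rw [← h1]
    have : √y < 1 := (Real.sqrt_lt' one_pos).2 (by linarith [hy.2.1])
    exact Real.sqrt_pos.2 (by linarith)
  · rw [h1]
    exact h

theorem admissible_startParam {a : ℝ} (ha0 : 0 < a) (ha : a < 1 / 4) {x : Fin n → ℝ}
    (hx : ∀ k, 0 ≤ x k) : Admissible (startParam 1 a x) x := by
  set γ := startParam 1 a x with hγ
  have hγ0 : 0 < γ := startParam_pos (by linarith) x
  have hγa : γ ≤ a := (startParam_le_self 1 a x).trans_eq (one_mul a)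
  have hsmall : ∀ k, 0 < x k → x k < 1 → x k ∈ smallOutputs 1 x := fun k h0 h1 =>
    ⟨h0, h1, k, (one_mul _).symm⟩
  have hk : ∀ k, x k = 0 ∨ γ ^ 2 ≤ x k := by
    intro k
    rcases (hx k).eq_or_lt with h0 | h0
    · exact Or.inl h0.symm
    · right
      rcases lt_or_ge (x k) 1 with h1 | h1
      · have : γ ≤ x k := startParam_le (Or.inl (Or.inl (hsmall k h0 h1)))
        nlinarith
      · nlinarith
  refine ⟨hx, fun i => ?_, fun i => ?_, fun i k _ _ => hk k⟩
  · by_cases h : ∃ k, k ≠ i ∧ x k ≠ 0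
    · obtain ⟨k, hki, h⟩ := h
      exact Or.inr (((hk k).resolve_left h).trans (le_othersOutput hx hki))
    · push Not at h
      exact Or.inl (sum_eq_zero fun k hk => h k (ne_of_mem_erase hk))
  · rcases (hx i).eq_or_lt with h0 | h0
    · left
      rw [← h0]
      norm_num
    · right
      rcases lt_or_ge (x i) 1 with h1 | h1
      · right
        have : γ ≤ √((1 - √(x i)) / 2) :=
          startParam_le (Or.inl (Or.inr ⟨x i, hsmall i h0 h1, rfl⟩))
        have h2 := pow_le_pow_left₀ hγ0.le this 2
        rw [Real.sq_sqrt (by linarith [(Real.sqrt_lt' one_pos).2 (h1.trans_eq (one_pow 2).symm)])] at h2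
        linarith
      · exact Or.inl h1

end StartParam

section Upper

variable {n : ℕ}

/-- Geometric decay at rate `q` brings `K` below `δ` after `log (K / δ) / q` steps. -/
theorem one_sub_pow_mul_le {q K δ : ℝ} (hq0 : 0 < q) (hq1 : q ≤ 1) (hK : 0 < K) (hδ : 0 < δ)
    {T : ℕ} (hT : Real.log (K / δ) / q ≤ T) : (1 - q) ^ T * K ≤ δ := by
  have h1 : (1 - q) ^ T ≤ δ / K := by
    calc (1 - q) ^ T ≤ Real.exp (-q) ^ T :=
          pow_le_pow_left₀ (by linarith) (Real.one_sub_le_exp_neg q) T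
      _ = Real.exp (-(T * q)) := by rw [← Real.exp_nat_mul]; ring_nf
      _ ≤ Real.exp (-Real.log (K / δ)) := by
          rw [Real.exp_le_exp]
          rw [div_le_iff₀ hq0] at hT
          linarith
      _ = δ / K := by rw [Real.exp_neg, Real.exp_log (by positivity), inv_div]
  calc (1 - q) ^ T * K ≤ δ / K * K := mul_le_mul_of_nonneg_right h1 hK.le
    _ = δ := div_mul_cancel₀ _ hK.ne'

variable [NeZero n] {γ a : ℝ} {x : Fin n → ℝ}

/-- Coupon collecting: soon every agent with a large output has moved. -/
theorem stepProb_not_settled_le (hγ : 0 < γ) (hγa : γ ≤ a) (ha : a < 1 / 4) (hx : Moved γ a x)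
    {δ : ℝ} (hδ : 0 < δ) {T : ℕ} (hT : n * Real.log (2 * n / δ) ≤ T) :
    stepProb (step 1 a) T (fun y => ¬ Settled γ a y) x ≤ δ := by
  have hn0 : (0 : ℝ) < n := Nat.cast_pos.2 (NeZero.pos n)
  have hn1 : (1 : ℝ) ≤ n := by exact_mod_cast NeZero.pos n
  have hq1 : (1 : ℝ) / n ≤ 1 := (div_le_one hn0).2 hn1
  have h := stepProb_le_of_drift (F := step 1 a) (R := Moved γ a)
    (fun y hy i => hy.moved_step hγ hγa ha i) (V := fun y => ∑ k, obstruction y k)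
    (ρ := 1 - 1 / n) (m := 1) (by linarith) one_pos
    (fun y _ => sum_nonneg fun k _ => obstruction_nonneg y k)
    (fun y hy => avg_obstruction_le ha hy.nonneg) (B := fun y => ¬ Settled γ a y)
    (fun y hy hB => one_le_sum_obstruction fun h => hB ⟨hy, h.1, h.2⟩) T hx
  refine h.trans ?_
  rw [div_one]
  refine le_trans (mul_le_mul_of_nonneg_left (sum_obstruction_le x)
    (pow_nonneg (by linarith) T)) ?_
  refine one_sub_pow_mul_le (by positivity) hq1 (by positivity) hδ ?_
  rw [div_div_eq_mul_div, div_one, mul_comm]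
  exact hT

/-- Once settled, the total output grows doubly exponentially up to `1 / 2`. -/
theorem stepProb_not_convexRegion_le (hn : 3 ≤ n) (hγ : 0 < γ) (hγa : γ ≤ a) (ha : a < 1 / 4)
    (hx : Settled γ a x) {δ : ℝ} (hδ : 0 < δ) {T : ℕ}
    (hT : 6 * Real.log (3 * Real.log (1 / γ) / δ) ≤ T) :
    stepProb (step 1 a) T (fun y => ¬ ConvexRegion y) x ≤ δ := by
  have hpos : ∀ y : Fin n → ℝ, Settled γ a y → 0 < total y := fun y hy => hγ.trans_le hy.le_total
  have hL : 0 < Real.log (1 / γ) := Real.log_pos (by rw [lt_div_iff₀ hγ]; linarith)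
  have h := stepProb_le_of_drift (F := step 1 a) (R := Settled γ a)
    (fun y hy i => hy.step hγ hγa ha i) (V := deficit)
    (ρ := 1 - 1 / 6) (m := 1 / 3) (by norm_num) (by norm_num)
    (fun y hy => deficit_nonneg (hpos y hy))
    (fun y hy => avg_deficit_le hn hγ hy) (B := fun y => ¬ ConvexRegion y)
    (fun y hy hB => ?_) T hx
  · refine h.trans ?_
    have hd : deficit x ≤ Real.log (1 / γ) := by
      unfold deficit
      split_ifs
      · refine Real.log_le_log (by have := hpos x hx; positivity) ?_
        rw [div_le_div_iff₀ (by have := hpos x hx; positivity) hγ]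
        linarith [hx.le_total]
      · exact hL.le
    calc (1 - 1 / 6 : ℝ) ^ T * deficit x / (1 / 3)
        ≤ (1 - 1 / 6 : ℝ) ^ T * (3 * Real.log (1 / γ)) := by
          have : (0 : ℝ) ≤ (1 - 1 / 6) ^ T := by norm_num
          nlinarith
      _ ≤ δ := one_sub_pow_mul_le (by norm_num) (by norm_num) (by positivity) hδ (by linarith)
  · have hs : total y < 1 / 2 := by
      by_contra! hs
      exact hB ⟨hy.nonneg, hy.le_quarter, hs, hy.total_le⟩
    have h0 := hpos y hy
    rw [deficit, if_pos hs]
    refine le_trans ?_ (Real.one_sub_inv_le_log_of_pos (by positivity))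
    rw [inv_div]
    linarith

/-- Random coordinate descent on a strongly convex potential converges linearly. -/
theorem stepProb_not_isApproxEquilibrium_le (hn : 3 ≤ n) (ha0 : 0 < a) (ha : a < 1 / 4)
    (hx : ConvexRegion x) {ε δ : ℝ} (hε0 : 0 < ε) (hε1 : ε < 1) (hδ : 0 < δ) {T : ℕ}
    (hT : 3 * n * Real.log (72 * n ^ 3 / ε / δ) ≤ T) :
    stepProb (step 1 a) T (fun y => ¬ IsApproxEquilibrium 1 ε y) x ≤ δ := by
  have hn0 : (0 : ℝ) < n := Nat.cast_pos.2 (NeZero.pos n)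
  have hn1 : (1 : ℝ) ≤ n := by exact_mod_cast NeZero.pos n
  have hq1 : 1 / (3 * n : ℝ) ≤ 1 := (div_le_one (by positivity)).2 (by linarith)
  have h := stepProb_le_of_drift (F := step 1 a) (R := ConvexRegion)
    (fun y hy i => hy.step ha0 ha i) (V := excess)
    (ρ := 1 - 1 / (3 * n)) (m := ε / (144 * n ^ 2)) (by linarith) (by positivity)
    (fun y hy => excess_nonneg hn hy.half_le)
    (fun y hy => hy.avg_excess_le hn) (B := fun y => ¬ IsApproxEquilibrium 1 ε y)
    (fun y hy hB => le_of_not_ge fun h => hB (hy.isApproxEquilibrium hn hε0 hε1 h)) T hx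
  refine h.trans ?_
  calc (1 - 1 / (3 * n) : ℝ) ^ T * excess x / (ε / (144 * n ^ 2))
      ≤ (1 - 1 / (3 * n) : ℝ) ^ T * (n / 2) / (ε / (144 * n ^ 2)) := by
        have := pow_nonneg (by linarith : (0 : ℝ) ≤ 1 - 1 / (3 * n)) T
        have := hx.excess_le hn
        gcongr
    _ = (1 - 1 / (3 * n) : ℝ) ^ T * (72 * n ^ 3 / ε) := by
        field_simp
        ring
    _ ≤ δ := one_sub_pow_mul_le (by positivity) hq1 (by positivity) hδ (by
        rw [div_div_eq_mul_div, div_one, mul_comm]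
        exact hT)

theorem exists_stepProb_le (hn : 3 ≤ n) (ha0 : 0 < a) (ha : a < 1 / 4) (hx : ∀ k, 0 ≤ x k)
    {ε δ : ℝ} (hε0 : 0 < ε) (hε1 : ε < 1) (hδ0 : 0 < δ) (hδ1 : δ < 1) :
    ∃ t : ℕ, (t : ℝ) ≤ 100 * (Real.log (Real.log (1 / startParam 1 a x))
        + n * Real.log (n / (ε * δ))) ∧
      stepProb (step 1 a) t (fun y => ¬ IsApproxEquilibrium 1 ε y) x ≤ δ := by
  have hx0 := admissible_startParam ha0 ha hx
  set γ := startParam 1 a x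
  have hγ : 0 < γ := startParam_pos (by linarith) x
  have hγa : γ ≤ a := (startParam_le_self 1 a x).trans_eq (one_mul a)
  have hn3 : (3 : ℝ) ≤ n := by exact_mod_cast hn
  have hlog3 : 1 ≤ Real.log 3 := by
    rw [Real.le_log_iff_exp_le (by norm_num)]
    linarith [Real.exp_one_lt_d9]
  have hεδ : ε * δ ≤ 1 := by nlinarith
  set Y := Real.log (n / (ε * δ)) with hY
  have hnY : (3 : ℝ) ≤ n / (ε * δ) := by
    rw [le_div_iff₀ (by positivity)]
    nlinarith
  have hY1 : 1 ≤ Y := hlog3.trans (Real.log_le_log (by norm_num) hnY)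
  have hL : 1 ≤ Real.log (1 / γ) := by
    refine hlog3.trans (Real.log_le_log (by norm_num) ?_)
    rw [le_div_iff₀ hγ]
    linarith
  have hLL : 0 ≤ Real.log (Real.log (1 / γ)) := Real.log_nonneg hL
  -- each of the three phases is allotted the failure probability `δ / 3`
  set A₁ : ℝ := n * Real.log (2 * n / (δ / 3)) with hA₁
  set A₂ : ℝ := 6 * Real.log (3 * Real.log (1 / γ) / (δ / 3)) with hA₂
  set A₃ : ℝ := 3 * n * Real.log (72 * n ^ 3 / ε / (δ / 3)) with hA₃
  have hlog : ∀ k : ℕ, Real.log ((3 : ℝ) ^ k) = k * Real.log 3 := fun k => Real.log_pow 3 k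
  have h3Y : Real.log 3 ≤ Y := Real.log_le_log (by norm_num) hnY
  have hYn : Real.log n - Real.log ε - Real.log δ = Y := by
    rw [hY, Real.log_div (by positivity) (by positivity), Real.log_mul hε0.ne' hδ0.ne']
    ring
  have hlogε := Real.log_nonpos hε0.le hε1.le
  have hlogδ := Real.log_nonpos hδ0.le hδ1.le
  have hlogn := Real.log_nonneg (by linarith : (1 : ℝ) ≤ n)
  have hB₁ : Real.log (2 * n / (δ / 3)) ≤ 3 * Y := by
    calc Real.log (2 * n / (δ / 3)) ≤ Real.log (3 ^ 2 * n / δ) := by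
          refine Real.log_le_log (by positivity) ?_
          rw [div_div_eq_mul_div]
          gcongr ?_ / _
          linarith
      _ = 2 * Real.log 3 + Real.log n - Real.log δ := by
          rw [Real.log_div (by positivity) hδ0.ne', Real.log_mul (by norm_num) (by positivity),
            hlog]
          norm_num
      _ ≤ 3 * Y := by linarith
  have hB₂ : Real.log (3 * Real.log (1 / γ) / (δ / 3)) ≤ Real.log (Real.log (1 / γ)) + 3 * Y := by
    have : 3 * Real.log (1 / γ) / (δ / 3) = 3 ^ 2 * Real.log (1 / γ) / δ := by
      ring
    rw [this, Real.log_div (by positivity) hδ0.ne', Real.log_mul (by norm_num) (by positivity),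
      hlog]
    push_cast
    linarith
  have hB₃ : Real.log (72 * n ^ 3 / ε / (δ / 3)) ≤ 8 * Y := by
    calc Real.log (72 * n ^ 3 / ε / (δ / 3)) ≤ Real.log (3 ^ 5 * n ^ 3 / ε / δ) := by
          refine Real.log_le_log (by positivity) ?_
          have : 72 * (n : ℝ) ^ 3 / ε / (δ / 3) = 216 * n ^ 3 / ε / δ := by ring
          rw [this]
          gcongr
          norm_num
      _ = 5 * Real.log 3 + 3 * Real.log n - Real.log ε - Real.log δ := by
          rw [Real.log_div (by positivity) hδ0.ne', Real.log_div (by positivity) hε0.ne',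
            Real.log_mul (by norm_num) (by positivity), hlog, Real.log_pow]
          norm_num
      _ ≤ 8 * Y := by linarith
  have hceil : ∀ A B : ℝ, A ≤ B → 0 ≤ B → (⌈A⌉₊ : ℝ) ≤ B + 1 := fun A B h h0 =>
    (Nat.cast_le.2 (Nat.ceil_mono h)).trans (Nat.ceil_lt_add_one h0).le
  have hnY0 : 3 * Y ≤ n * Y := mul_le_mul_of_nonneg_right hn3 (by linarith)
  have hC₁ : (⌈A₁⌉₊ : ℝ) ≤ 3 * (n * Y) + 1 :=
    hceil _ _ (by rw [hA₁]; nlinarith) (by linarith)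
  have hC₂ : (⌈A₂⌉₊ : ℝ) ≤ 6 * (Real.log (Real.log (1 / γ)) + 3 * Y) + 1 :=
    hceil _ _ (by rw [hA₂]; linarith) (by linarith)
  have hC₃ : (⌈A₃⌉₊ : ℝ) ≤ 24 * (n * Y) + 1 :=
    hceil _ _ (by rw [hA₃]; nlinarith) (by linarith)
  refine ⟨⌈A₁⌉₊ + (⌈A₂⌉₊ + ⌈A₃⌉₊) + 1, ?_, ?_⟩
  · push_cast
    linarith
  · refine stepProb_succ_le fun i => ?_
    have hδ3 : 0 < δ / 3 := by positivity
    have hmoved := hx0.moved_step hγ hγa ha i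
    have h := stepProb_add_le (F := step 1 a) (R := Moved γ a)
      (fun y hy i => hy.moved_step hγ hγa ha i) (B := fun y => ¬ IsApproxEquilibrium 1 ε y)
      (B' := fun y => ¬ Settled γ a y) (s := ⌈A₂⌉₊ + ⌈A₃⌉₊) (q := δ / 3 + δ / 3) hmoved
      (by positivity) (stepProb_not_settled_le hγ hγa ha hmoved hδ3 (Nat.le_ceil A₁)) ?_
    · linarith
    · intro y _ hy
      have hy := not_not.1 hy
      refine stepProb_add_le (F := step 1 a) (R := Settled γ a)
        (fun y hy i => hy.step hγ hγa ha i) (B := fun y => ¬ IsApproxEquilibrium 1 ε y)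
        (B' := fun y => ¬ ConvexRegion y) hy (by positivity)
        (stepProb_not_convexRegion_le hn hγ hγa ha hy hδ3 (Nat.le_ceil A₂)) fun z _ hz => ?_
      exact stepProb_not_isApproxEquilibrium_le hn ha0 ha (not_not.1 hz) hε0 hε1 hδ3
        (Nat.le_ceil A₃)

theorem upper_bound {κ a : ℝ} (hn : 3 ≤ n) (hκ : 0 < κ) (ha0 : 0 < a) (ha : κ * a < 1 / 4)
    {x₀ : Fin n → ℝ} (hx : ∀ k, 0 ≤ x₀ k) {ε δ : ℝ} (hε0 : 0 < ε) (hε1 : ε < 1) (hδ0 : 0 < δ)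
    (hδ1 : δ < 1) :
    1 - δ ≤ (uniformMovers n).real {i | ∃ t : ℕ,
      (t : ℝ) ≤ 100 * (Real.log (Real.log (1 / startParam κ a x₀))
        + n * Real.log (n / (ε * δ))) ∧ IsApproxEquilibrium κ ε (profile κ a x₀ i t)} := by
  obtain ⟨t, ht, h⟩ := exists_stepProb_le hn (mul_pos hκ ha0) ha
    (x := fun k => κ * x₀ k) (fun k => mul_nonneg hκ.le (hx k)) hε0 hε1 hδ0 hδ1
  rw [startParam_mul] at ht
  refine one_sub_le_measureReal h fun ω hω => ⟨t, ht, ?_⟩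
  rw [not_not, ← mul_profile hκ, isApproxEquilibrium_mul hκ] at hω
  exact hω

end Upper

/-! ### Approximate equilibria and the distance to the Nash equilibrium -/

section Interior

variable {n : ℕ} {a : ℝ} {x : Fin n → ℝ}

/-- Profiles at which every agent has a strictly positive best response. -/
structure Interior (x : Fin n → ℝ) : Prop where
  nonneg : ∀ k, 0 ≤ x k
  total_lt : total x < 1
  others_pos : ∀ i, 0 < othersOutput x i

namespace Interior

theorem othersOutput_lt_one (hx : Interior x) (i : Fin n) : othersOutput x i < 1 := by
  linarith [othersOutput_eq x i, hx.nonneg i, hx.total_lt]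

theorem step_self_eq (hx : Interior x) (i : Fin n) :
    LotteryContest.step 1 a x i i = √(othersOutput x i) - othersOutput x i := by
  rw [step_self, bestResponse_of_le_one a (hx.others_pos i) (hx.othersOutput_lt_one i).le]

theorem total_step_eq (hx : Interior x) (i : Fin n) :
    total (LotteryContest.step 1 a x i) = √(othersOutput x i) :=
  total_step_of_le_one a (hx.others_pos i) (hx.othersOutput_lt_one i).le

theorem step_self_pos (hx : Interior x) (i : Fin n) : 0 < LotteryContest.step 1 a x i i := by
  rw [hx.step_self_eq, sub_pos]
  have := hx.others_pos i
  have := hx.othersOutput_lt_one i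
  exact Real.lt_sqrt_of_sq_lt (by nlinarith)

theorem step (hx : Interior x) (i : Fin n) : Interior (step 1 a x i) := by
  have hnn : ∀ k, 0 ≤ LotteryContest.step 1 a x i k := by
    intro k
    by_cases hk : k = i
    · subst hk
      exact (hx.step_self_pos k).le
    · rw [step_of_ne _ _ _ hk]
      exact hx.nonneg k
  refine ⟨hnn, ?_, fun k => ?_⟩
  · rw [hx.total_step_eq, Real.sqrt_lt' one_pos, one_pow]
    exact hx.othersOutput_lt_one i
  · by_cases hk : i = k
    · subst hk
      rw [othersOutput_step]
      exact hx.others_pos i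
    · exact (hx.step_self_pos i).trans_le (le_othersOutput hnn hk)

theorem total_pos (hx : Interior x) [NeZero n] : 0 < total x := by
  linarith [hx.others_pos 0, othersOutput_eq x 0, hx.nonneg 0]

/-- The total output grows at most doubly exponentially. -/
theorem sq_total_step_le (hx : Interior x) (i : Fin n) :
    total (LotteryContest.step 1 a x i) ^ 2 ≤ total x := by
  rw [hx.total_step_eq, Real.sq_sqrt (hx.others_pos i).le, othersOutput_eq]
  linarith [hx.nonneg i]

theorem exists_responder_step (hx : Interior x) (i : Fin n) :
    ∃ j, LotteryContest.step 1 a x i j = total (LotteryContest.step 1 a x i)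
      - total (LotteryContest.step 1 a x i) ^ 2 := by
  refine ⟨i, ?_⟩
  rw [hx.step_self_eq, hx.total_step_eq, Real.sq_sqrt (hx.others_pos i).le]

theorem isApproxEquilibrium_iff (hx : Interior x) {ε : ℝ} (hε : ε < 1) [NeZero n] :
    IsApproxEquilibrium 1 ε x ↔ ∀ i, (total x - √(othersOutput x i)) ^ 2
      ≤ ε * (1 - √(othersOutput x i)) ^ 2 * total x := by
  rw [LotteryContest.isApproxEquilibrium_iff hε hx.nonneg hx.others_pos
    fun i => (hx.othersOutput_lt_one i).le]
  simp only [div_le_iff₀ hx.total_pos]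

/-- In an approximate equilibrium every utility is at least the fraction `1 - ε` of the
optimum. -/
theorem one_sub_mul_le (hx : Interior x) {ε : ℝ} (hε : ε < 1) [NeZero n]
    (h : IsApproxEquilibrium 1 ε x) (i : Fin n) :
    (1 - ε) * (1 - √(othersOutput x i)) ^ 2 * total x ≤ (1 - total x) * x i := by
  have h1 := (hx.isApproxEquilibrium_iff hε).1 h i
  have hr := Real.sq_sqrt (hx.others_pos i).le
  have hxi : x i = total x - √(othersOutput x i) ^ 2 := by
    rw [hr, othersOutput_eq]
    ring
  rw [hxi]
  linarith

/-- An agent with zero output would gain an arbitrarily large factor by responding. -/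
theorem not_isApproxEquilibrium (hx : Interior x) {ε : ℝ} (hε : ε < 1) [NeZero n] {i : Fin n}
    (hi : x i = 0) : ¬ IsApproxEquilibrium 1 ε x := by
  intro h
  have h1 := hx.one_sub_mul_le hε h i
  rw [hi, mul_zero] at h1
  have h2 : √(othersOutput x i) < 1 := by
    rw [Real.sqrt_lt' one_pos, one_pow]
    exact hx.othersOutput_lt_one i
  have h3 : 0 < 1 - √(othersOutput x i) := by linarith
  have := hx.total_pos
  have h4 : 0 < 1 - ε := by linarith
  have : 0 < (1 - ε) * (1 - √(othersOutput x i)) ^ 2 * total x := by positivity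
  linarith

/-- The last mover leaves little output to the others, so that one of them is far from optimal
while the total output is small. -/
theorem quarter_le_or_le (hn : 3 ≤ n) (hx : Interior x) {ε : ℝ} (hε : ε < 1) [NeZero n]
    {j : Fin n} (hj : x j = total x - total x ^ 2) (h : IsApproxEquilibrium 1 ε x) :
    1 / 4 ≤ total x ∨ (1 - ε) / 2 ≤ total x := by
  have h0 := hx.total_pos
  obtain ⟨i, hij, hi⟩ : ∃ i, i ≠ j ∧ x i ≤ total x ^ 2 / 2 := by
    have hc : 1 < (univ.erase j).card := by
      rw [card_erase_of_mem (mem_univ j), card_univ, Fintype.card_fin]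
      omega
    obtain ⟨p, hp, q, hq, hpq⟩ := one_lt_card.1 hc
    have h1 := add_add_le_total hx.nonneg hpq (ne_of_mem_erase hp) (ne_of_mem_erase hq)
    rcases le_total (x p) (x q) with h2 | h2
    · exact ⟨p, ne_of_mem_erase hp, by linarith⟩
    · exact ⟨q, ne_of_mem_erase hq, by linarith⟩
  by_contra! hs
  have h1 := hx.one_sub_mul_le hε h i
  have hr : √(othersOutput x i) ≤ 1 / 2 := by
    rw [Real.sqrt_le_iff]
    exact ⟨by norm_num, by linarith [othersOutput_eq x i, hx.nonneg i]⟩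
  have hr2 : 1 / 4 ≤ (1 - √(othersOutput x i)) ^ 2 := by nlinarith
  have h2 : (1 - ε) * (1 / 4) * total x ≤ total x ^ 2 / 2 := by
    calc (1 - ε) * (1 / 4) * total x ≤ (1 - ε) * (1 - √(othersOutput x i)) ^ 2 * total x :=
          mul_le_mul_of_nonneg_right (mul_le_mul_of_nonneg_left hr2 (by linarith)) h0.le
      _ ≤ (1 - total x) * x i := h1
      _ ≤ total x ^ 2 / 2 := by nlinarith [hx.nonneg i]
  nlinarith

/-- An approximate equilibrium with substantial output is close to the Nash equilibrium. -/
theorem abs_sub_eqOutput_le (hn : 3 ≤ n) (hx : Interior x) {ε : ℝ} (hε0 : 0 < ε) (hε : ε < 1)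
    [NeZero n] (hs : 1 / 4 ≤ total x) (h : IsApproxEquilibrium 1 ε x) (i : Fin n) :
    |x i - eqOutput n| ≤ 10 * √ε := by
  have hn0 : (0 : ℝ) < n := Nat.cast_pos.2 (NeZero.pos n)
  have hs1 := hx.total_lt
  have hdev : ∀ k, |x k - (total x - total x ^ 2)| ≤ 2 * √ε := by
    intro k
    have hk := (hx.isApproxEquilibrium_iff hε).1 h k
    have hr := Real.sq_sqrt (hx.others_pos k).le
    have hr0 := Real.sqrt_nonneg (othersOutput x k)
    have hr1 := Real.sqrt_le_one.2 (hx.othersOutput_lt_one k).le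
    have hxk : x k - (total x - total x ^ 2) = (total x - √(othersOutput x k))
        * (total x + √(othersOutput x k)) := by
      have := othersOutput_eq x k
      nlinarith
    set r := √(othersOutput x k)
    have h1 : (total x - r) ^ 2 ≤ ε := by
      have : (1 - r) ^ 2 * total x ≤ 1 := by nlinarith [mul_nonneg hr0 (sub_nonneg.2 hr1)]
      nlinarith
    rw [hxk, abs_mul, abs_of_nonneg (by linarith : 0 ≤ total x + r), mul_comm 2]
    exact mul_le_mul (Real.abs_le_sqrt h1) (by linarith) (by linarith) (Real.sqrt_nonneg _)
  have hsum : |total x - n * (total x - total x ^ 2)| ≤ n * (2 * √ε) := by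
    calc |total x - n * (total x - total x ^ 2)|
        = |∑ k, (x k - (total x - total x ^ 2))| := by
          rw [sum_sub_distrib, sum_const, card_univ, Fintype.card_fin, nsmul_eq_mul]
          rfl
      _ ≤ ∑ k, |x k - (total x - total x ^ 2)| := abs_sum_le_sum_abs _ _
      _ ≤ ∑ _k : Fin n, 2 * √ε := sum_le_sum fun k _ => hdev k
      _ = n * (2 * √ε) := by simp
  have hfac : total x - n * (total x - total x ^ 2) = n * (total x * (total x - eqTotal n)) := by
    unfold eqTotal
    field_simp
    ring
  rw [hfac, abs_mul, abs_of_pos hn0, mul_le_mul_iff_right₀ hn0, abs_mul,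
    abs_of_pos (by linarith : 0 < total x)] at hsum
  have hS : |total x - eqTotal n| ≤ 8 * √ε := by
    nlinarith [abs_nonneg (total x - eqTotal n)]
  have hS1 := two_thirds_le_eqTotal hn
  have hS2 := eqTotal_le_one n
  have hmid : |total x - total x ^ 2 - eqOutput n| ≤ 8 * √ε := by
    have : total x - total x ^ 2 - eqOutput n
        = (total x - eqTotal n) * (1 - total x - eqTotal n) := by
      rw [eqOutput_eq]
      ring
    rw [this, abs_mul]
    have h1 : |1 - total x - eqTotal n| ≤ 1 := by
      rw [abs_le]
      constructor <;> linarith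
    calc _ ≤ |total x - eqTotal n| * 1 := mul_le_mul_of_nonneg_left h1 (abs_nonneg _)
      _ ≤ 8 * √ε := by linarith
  calc |x i - eqOutput n| ≤ |x i - (total x - total x ^ 2)| + |total x - total x ^ 2 - eqOutput n| :=
        abs_sub_le _ _ _
    _ ≤ 10 * √ε := by linarith [hdev i]

/-- A move reduces the distance to the Nash equilibrium at most by a factor of order `n`: the mover
`j` before it had responded to the old output of the present mover `i`, and the best response
determines the aggregate output of the opponents up to a bounded factor. -/
theorem abs_sub_eqOutput_le_of_step (hn : 3 ≤ n) (hx : Interior x) [NeZero n] {i j : Fin n}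
    (hj : x j = total x - total x ^ 2) {η : ℝ} (hη : n * η ≤ 1 / 50)
    (h : ∀ k, |LotteryContest.step 1 a x i k - eqOutput n| ≤ η) (k : Fin n) :
    |x k - eqOutput n| ≤ 7 * n * η := by
  have hn0 : (0 : ℝ) < n := Nat.cast_pos.2 (NeZero.pos n)
  have hn3 : (3 : ℝ) ≤ n := by exact_mod_cast hn
  have hη0 : 0 ≤ η := (abs_nonneg _).trans (h k)
  have hle : η ≤ 7 * n * η := by nlinarith
  have hne : ∀ k, k ≠ i → |x k - eqOutput n| ≤ η := fun k hk => by
    rw [← step_of_ne 1 a x hk]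
    exact h k
  by_cases hk : k = i
  swap
  · exact (hne k hk).trans hle
  subst hk
  have hs0 := hx.total_pos
  have hs1 := hx.total_lt
  by_cases hkj : k = j
  · subst hkj
    have hS : othersOutput x k = total x ^ 2 := by
      rw [othersOutput_eq, hj]
      ring
    have := h k
    rw [hx.step_self_eq, hS, Real.sqrt_sq hs0.le, ← hj] at this
    exact this.trans hle
  -- the aggregate output of the agents other than `j` and `k`
  set W := ∑ l ∈ (univ.erase j).erase k, x l with hW
  have hmem : k ∈ univ.erase j := mem_erase.2 ⟨hkj, mem_univ k⟩
  have hWs : x k + W = total x ^ 2 := by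
    rw [hW, add_sum_erase _ x hmem]
    have := othersOutput_eq x j
    rw [othersOutput] at this
    linarith
  have hcard : (((univ.erase j).erase k).card : ℝ) = n - 2 := by
    rw [card_erase_of_mem hmem, card_erase_of_mem (mem_univ j), card_univ, Fintype.card_fin,
      Nat.sub_sub, Nat.cast_sub (by omega)]
    norm_num
  have hWn : |W - (n - 2) * eqOutput n| ≤ (n - 2) * η := by
    calc |W - (n - 2) * eqOutput n| = |∑ l ∈ (univ.erase j).erase k, (x l - eqOutput n)| := by
          rw [sum_sub_distrib, sum_const, nsmul_eq_mul, hcard]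
      _ ≤ ∑ l ∈ (univ.erase j).erase k, |x l - eqOutput n| := abs_sum_le_sum_abs _ _
      _ ≤ ∑ _l ∈ (univ.erase j).erase k, η :=
          sum_le_sum fun l hl => hne l (ne_of_mem_erase hl)
      _ = (n - 2) * η := by rw [sum_const, nsmul_eq_mul, hcard]
  have hjη := hne j (Ne.symm hkj)
  set s := total x
  set E := eqTotal n with hE
  have hnp : n * eqOutput n = E := natCast_mul_eqOutput
  have hpE : eqOutput n = E - E ^ 2 := eqOutput_eq
  have hE1 : E ≤ 1 := eqTotal_le_one n
  have hE2 : 2 / 3 ≤ E := two_thirds_le_eqTotal hn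
  -- both total outputs lie where `u - u ^ 2` is strictly decreasing, hence injective
  have hsE : (1 / 10 : ℝ) ≤ s + E - 1 := by
    have h1 : (n - 2) * eqOutput n = 2 * E ^ 2 - E := by
      rw [sub_mul, hnp, hpE]
      ring
    have h2 : 2 * E ^ 2 - E - 1 / 50 ≤ s ^ 2 := by
      linarith [(abs_le.1 hWn).1, hx.nonneg k]
    by_contra! h3
    nlinarith
  have hsd : |s - E| ≤ 10 * η := by
    have h1 : x j - eqOutput n = -((s - E) * (s + E - 1)) := by
      rw [hj, hpE]
      ring
    rw [h1, abs_neg, abs_mul, abs_of_pos (by linarith : 0 < s + E - 1)] at hjη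
    nlinarith [abs_nonneg (s - E)]
  have hsq : |s ^ 2 - E ^ 2| ≤ 20 * η := by
    rw [sq_sub_sq, abs_mul, abs_of_pos (by linarith : 0 < s + E)]
    nlinarith [abs_nonneg (s - E)]
  have hdec : x k - eqOutput n = (s ^ 2 - E ^ 2) - (W - (n - 2) * eqOutput n) := by
    linarith
  rw [hdec]
  calc _ ≤ |s ^ 2 - E ^ 2| + |W - (n - 2) * eqOutput n| := abs_sub _ _
    _ ≤ 7 * n * η := by nlinarith

end Interior

end Interior

/-! ### Idle agents and the slow initial profile -/

section Zeros

variable {n : ℕ} {a : ℝ} {x : Fin n → ℝ}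

open Classical in
/-- The number of agents with zero output. -/
noncomputable def zeros (x : Fin n → ℝ) : ℕ := (univ.filter fun k => x k = 0).card

theorem Interior.zeros_step (hx : Interior x) (i : Fin n) :
    (zeros (LotteryContest.step 1 a x i) : ℝ) = zeros x - if x i = 0 then 1 else 0 := by
  classical
  have h : (univ.filter fun k => LotteryContest.step 1 a x i k = 0)
      = (univ.filter fun k => x k = 0).erase i := by
    ext k
    by_cases hk : k = i
    · subst hk
      simpa using (hx.step_self_pos (a := a) k).ne'
    · simp [step_of_ne 1 a x hk, hk]
  unfold zeros
  split_ifs with hi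
  · have hm : i ∈ univ.filter fun k => x k = 0 := by simpa using hi
    rw [← card_erase_add_one hm, h]
    push_cast
    ring
  · rw [h, erase_eq_of_notMem (by simpa using hi), sub_zero]

theorem sum_ite_eq_zero (x : Fin n → ℝ) (c : ℝ) :
    (∑ i, if x i = 0 then c else 0) = zeros x * c := by
  classical
  rw [← sum_filter, sum_const, nsmul_eq_mul, zeros]

/-- The reciprocal of one plus the number of idle agents grows slowly in expectation. -/
theorem Interior.avg_inv_zeros_le [NeZero n] (hx : Interior x) :
    avg (LotteryContest.step 1 a) (fun y => ((zeros y : ℝ) + 1)⁻¹) x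
      ≤ (1 + 1 / n) * ((zeros x : ℝ) + 1)⁻¹ := by
  have hn0 : (0 : ℝ) < n := Nat.cast_pos.2 (NeZero.pos n)
  set z : ℝ := (zeros x : ℝ) with hz
  have hz0 : 0 ≤ z := Nat.cast_nonneg _
  have hstep : ∀ i, ((zeros (LotteryContest.step 1 a x i) : ℝ) + 1)⁻¹
      = (z + 1)⁻¹ + if x i = 0 then z⁻¹ - (z + 1)⁻¹ else 0 := by
    intro i
    rw [hx.zeros_step]
    split_ifs <;> simp [← hz]
  unfold avg
  rw [div_le_iff₀ hn0]
  simp only [hstep]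
  rw [sum_add_distrib, sum_ite_eq_zero, sum_const, card_univ, Fintype.card_fin, nsmul_eq_mul,
    ← hz]
  have h1 : z * (z⁻¹ - (z + 1)⁻¹) ≤ (z + 1)⁻¹ := by
    have h2 : z * z⁻¹ ≤ 1 := mul_inv_le_one
    have h3 : (z + 1) * (z + 1)⁻¹ = 1 := mul_inv_cancel₀ (by linarith)
    linarith
  have h2 : (1 + 1 / (n : ℝ)) * (z + 1)⁻¹ * n = n * (z + 1)⁻¹ + (z + 1)⁻¹ := by
    field_simp
  linarith

theorem Interior.profile (hx : Interior x) (ω : ℕ → Fin n) (t : ℕ) :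
    Interior (profile 1 a x ω t) := by
  induction t with
  | zero => exact hx
  | succ t ih => exact ih.step _

theorem Interior.zeros_profile_antitone (hx : Interior x) (ω : ℕ → Fin n) :
    Antitone fun t => zeros (LotteryContest.profile 1 a x ω t) := by
  refine antitone_nat_of_succ_le fun t => ?_
  have h := (hx.profile (a := a) ω t).zeros_step (a := a) (ω t)
  rw [← profile_succ] at h
  have h2 : (0 : ℝ) ≤ if LotteryContest.profile 1 a x ω t (ω t) = 0 then 1 else 0 := by
    split_ifs <;> norm_num
  have h3 : (zeros (LotteryContest.profile 1 a x ω (t + 1)) : ℝ)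
      ≤ zeros (LotteryContest.profile 1 a x ω t) := by linarith
  exact_mod_cast h3

theorem Interior.zeros_le_zeros_profile_add (hx : Interior x) (ω : ℕ → Fin n) (t : ℕ) :
    zeros x ≤ zeros (LotteryContest.profile 1 a x ω t) + t := by
  induction t with
  | zero => exact le_rfl
  | succ t ih =>
    have h := (hx.profile (a := a) ω t).zeros_step (a := a) (ω t)
    rw [← profile_succ] at h
    have h2 : (if LotteryContest.profile 1 a x ω t (ω t) = 0 then (1 : ℝ) else 0) ≤ 1 := by
      split_ifs <;> norm_num
    have h3 : (zeros (LotteryContest.profile 1 a x ω t) : ℝ)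
        ≤ zeros (LotteryContest.profile 1 a x ω (t + 1)) + 1 := by linarith
    have h4 : zeros (LotteryContest.profile 1 a x ω t)
        ≤ zeros (LotteryContest.profile 1 a x ω (t + 1)) + 1 := by exact_mod_cast h3
    omega

theorem Interior.not_isApproxEquilibrium_of_zeros_pos [NeZero n] (hx : Interior x) {ε : ℝ}
    (hε : ε < 1) (hz : 0 < zeros x) : ¬ IsApproxEquilibrium 1 ε x := by
  classical
  obtain ⟨i, hi⟩ := card_pos.1 hz
  exact hx.not_isApproxEquilibrium hε (mem_filter.1 hi).2

theorem Interior.total_profile_pow_le [NeZero n] (hx : Interior x) (ω : ℕ → Fin n) (t : ℕ) :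
    total (LotteryContest.profile 1 a x ω t) ^ 2 ^ t ≤ total x := by
  induction t with
  | zero => simp [LotteryContest.profile]
  | succ t ih =>
    have h := hx.profile (a := a) ω t
    rw [profile_succ, pow_succ', pow_mul]
    exact (pow_le_pow_left₀ (sq_nonneg _) (h.sq_total_step_le _) _).trans ih

end Zeros

section SlowStart

variable {n : ℕ}

/-- The initial profile for the lower bound: two agents with small outputs of the order `γ`, in a
ratio that keeps the profile away from the Nash equilibrium, and nobody else producing. -/
def slowStart (n : ℕ) (γ : ℝ) (k : Fin n) : ℝ :=
  (if k.val = 0 then γ else 0) + (if k.val = 1 then 2 * γ else 0)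

variable {γ a : ℝ}

theorem slowStart_nonneg (hγ : 0 < γ) (k : Fin n) : 0 ≤ slowStart n γ k := by
  unfold slowStart
  split_ifs <;> linarith

theorem total_slowStart (hn : 3 ≤ n) (γ : ℝ) : total (slowStart n γ) = 3 * γ := by
  have h : slowStart n γ = fun k => (if k = ⟨0, by omega⟩ then γ else 0)
      + (if k = ⟨1, by omega⟩ then 2 * γ else 0) := by
    funext k
    simp [slowStart, Fin.ext_iff]
  rw [total, h, sum_add_distrib, sum_ite_eq', sum_ite_eq']
  simp
  ring

theorem startParam_slowStart (hn : 3 ≤ n) (hγ : 0 < γ) (hγa : γ ≤ a) (ha : a < 1 / 4) :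
    startParam 1 a (slowStart n γ) = γ := by
  have hsmall : ∀ y ∈ smallOutputs 1 (slowStart n γ), y = γ ∨ y = 2 * γ := by
    rintro y ⟨h0, -, i, rfl⟩
    rw [one_mul] at *
    unfold slowStart at *
    split_ifs at * with h1 h2 h2
    · omega
    · simp
    · simp
    · simp at h0
  refine le_antisymm (startParam_le (Or.inl (Or.inl ⟨hγ, by linarith, ⟨0, by omega⟩, ?_⟩))) ?_
  · simp [slowStart]
  · rcases startParam_mem 1 a (slowStart n γ) with (h | ⟨y, hy, h⟩) | h
    · rcases hsmall _ h with h | h <;> linarith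
    · rw [← h]
      refine Real.le_sqrt_of_sq_le ?_
      have h1 : √y ≤ 3 / 4 := by
        rw [Real.sqrt_le_iff]
        refine ⟨by norm_num, ?_⟩
        rcases hsmall y hy with h | h <;> linarith
      nlinarith
    · rw [h, one_mul]
      exact hγa

theorem interior_slowStart (hn : 3 ≤ n) (hγ : 0 < γ) (hγ4 : γ < 1 / 4) :
    Interior (slowStart n γ) := by
  refine ⟨slowStart_nonneg hγ, by rw [total_slowStart hn]; linarith, fun i => ?_⟩
  by_cases hi : i.val = 0
  · refine lt_of_lt_of_le (?_ : 0 < slowStart n γ ⟨1, by omega⟩)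
      (le_othersOutput (slowStart_nonneg hγ) (by simp [Fin.ext_iff, hi]))
    simp [slowStart, hγ]
  · refine lt_of_lt_of_le (?_ : 0 < slowStart n γ ⟨0, by omega⟩)
      (le_othersOutput (slowStart_nonneg hγ) (by simp only [ne_eq, Fin.ext_iff]; omega))
    simp [slowStart, hγ]

theorem le_zeros_slowStart (hn : 3 ≤ n) (γ : ℝ) : n - 2 ≤ zeros (slowStart n γ) := by
  classical
  have h : univ \ {⟨0, by omega⟩, ⟨1, by omega⟩} ⊆
      univ.filter fun k : Fin n => slowStart n γ k = 0 := by
    intro k hk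
    simp only [mem_sdiff, mem_univ, mem_insert, mem_singleton, Fin.ext_iff, true_and,
      not_or] at hk
    exact mem_filter.2 ⟨mem_univ k, by simp [slowStart, hk.1, hk.2]⟩
  refine le_trans ?_ (card_le_card h)
  refine le_trans ?_ (le_card_sdiff _ _)
  rw [card_univ, Fintype.card_fin]
  exact Nat.sub_le_sub_left card_le_two n

theorem two_thirds_div_le_eqOutput [NeZero n] (hn : 3 ≤ n) : 2 / 3 / n ≤ eqOutput n :=
  div_le_div_of_nonneg_right (two_thirds_le_eqTotal hn) (Nat.cast_nonneg n)

/-- After the first move the profile is still away from the Nash equilibrium. -/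
theorem exists_le_abs_sub_step_slowStart [NeZero n] (hn : 3 ≤ n) (γ : ℝ) (i : Fin n) :
    ∃ k, 1 / (50 * n) ≤ |step 1 a (slowStart n γ) i k - eqOutput n| := by
  have hn0 : (0 : ℝ) < n := Nat.cast_pos.2 (NeZero.pos n)
  have hp := two_thirds_div_le_eqOutput hn
  have hq : (0 : ℝ) < (n : ℝ)⁻¹ := by positivity
  rw [div_eq_mul_inv] at hp
  rw [← one_div_mul_one_div]
  by_contra! h
  have hval : ∀ k, k ≠ i → |slowStart n γ k - eqOutput n| < 1 / 50 * (1 / n) := fun k hk => by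
    have := h k
    rw [step_of_ne _ _ _ hk] at this
    linarith
  by_cases hi : i.val ≤ 1
  · have h2 := abs_lt.1 (hval ⟨2, by omega⟩ (by simp only [ne_eq, Fin.ext_iff]; omega))
    simp only [slowStart] at h2
    norm_num at h2
    linarith
  · have h0 := abs_lt.1 (hval ⟨0, by omega⟩ (by simp only [ne_eq, Fin.ext_iff]; omega))
    have h1 := abs_lt.1 (hval ⟨1, by omega⟩ (by simp only [ne_eq, Fin.ext_iff]; omega))
    simp only [slowStart] at h0 h1
    norm_num at h0 h1
    linarith

/-- Along every trajectory the distance to the Nash equilibrium decays at most geometrically. -/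
theorem exists_pow_le_abs_sub_profile [NeZero n] (hn : 3 ≤ n) (hγ : 0 < γ) (hγ4 : γ < 1 / 4)
    (ω : ℕ → Fin n) (t : ℕ) :
    ∃ k, (1 / (50 * n : ℝ)) ^ (t + 1)
      ≤ |profile 1 a (slowStart n γ) ω (t + 1) k - eqOutput n| := by
  have hn0 : (0 : ℝ) < n := Nat.cast_pos.2 (NeZero.pos n)
  have hn1 : (1 : ℝ) ≤ n := by exact_mod_cast NeZero.pos n
  induction t with
  | zero =>
    rw [zero_add, pow_one]
    exact exists_le_abs_sub_step_slowStart hn γ (ω 0)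
  | succ t ih =>
    by_contra! h
    obtain ⟨k, hk⟩ := ih
    have hint := (interior_slowStart hn hγ hγ4).profile (a := a) ω t
    obtain ⟨j, hj⟩ := hint.exists_responder_step (a := a) (ω t)
    set q : ℝ := (1 / (50 * n : ℝ)) ^ (t + 1) with hq
    have hq0 : 0 < q := by positivity
    have hq1 : q ≤ 1 := pow_le_one₀ (by positivity)
      ((div_le_one (by positivity)).2 (by linarith))
    have hmul : n * (1 / (50 * n : ℝ)) ^ (t + 1 + 1) = q / 50 := by
      rw [pow_succ, ← hq]
      field_simp
    have h1 := (hint.step (ω t)).abs_sub_eqOutput_le_of_step (a := a) hn (i := ω (t + 1)) hj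
      (η := (1 / (50 * n : ℝ)) ^ (t + 1 + 1)) (by rw [hmul]; linarith) (fun k => (h k).le) k
    rw [profile_succ] at hk
    rw [mul_assoc, hmul] at h1
    linarith

/-- Every trajectory needs doubly logarithmic time. -/
theorem log_log_add_log_log_le [NeZero n] (hn : 3 ≤ n) (hγ : 0 < γ) (hγ4 : γ < 1 / 4)
    (ω : ℕ → Fin n) {t : ℕ} (hnt : n ≤ t + 2) {ε : ℝ} (hε0 : 0 < ε) (hε1 : ε < 1)
    (h : IsApproxEquilibrium 1 ε (profile 1 a (slowStart n γ) ω t)) :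
    Real.log (Real.log (1 / ε)) + Real.log (Real.log (1 / γ)) ≤ 20 * t := by
  have hn0 : (0 : ℝ) < n := Nat.cast_pos.2 (NeZero.pos n)
  obtain ⟨u, rfl⟩ : ∃ u, t = u + 1 := ⟨t - 1, by omega⟩
  have hint₀ := interior_slowStart hn hγ hγ4
  have hint := hint₀.profile (a := a) ω (u + 1)
  have hpow := hint₀.total_profile_pow_le (a := a) ω (u + 1)
  rw [total_slowStart hn] at hpow
  obtain ⟨j, hj⟩ := (hint₀.profile (a := a) ω u).exists_responder_step (a := a) (ω u)
  rw [← profile_succ] at hj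
  have hs := hint.quarter_le_or_le hn hε1 hj h
  obtain ⟨k, hk⟩ := exists_pow_le_abs_sub_profile (a := a) hn hγ hγ4 ω u
  have hdist := fun h1 => hint.abs_sub_eqOutput_le hn hε0 hε1 h1 h k
  have hs0 := hint.total_pos
  set s := total (profile 1 a (slowStart n γ) ω (u + 1))
  set t := u + 1 with ht
  have ht1 : (1 : ℝ) ≤ t := by rw [ht]; push_cast; linarith [(Nat.cast_nonneg u : (0 : ℝ) ≤ u)]
  have hη : 0 < 1 - ε := by linarith
  have h2t : (0 : ℝ) < 2 ^ t := by positivity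
  -- the total output cannot have grown fast
  have hLγ : Real.log (1 / γ) ≤ 5 * (2 ^ t * Real.log (1 / s)) := by
    have h1 : Real.log (1 / (3 * γ)) ≤ 2 ^ t * Real.log (1 / s) := by
      have := Real.log_le_log (by positivity) hpow
      rw [Real.log_pow] at this
      rw [one_div, one_div, Real.log_inv, Real.log_inv]
      push_cast at this
      linarith
    have h2 : Real.log 3 ≤ 4 * Real.log (1 / (3 * γ)) := by
      rw [show (4 : ℝ) = ((4 : ℕ) : ℝ) by norm_num, ← Real.log_pow]
      refine Real.log_le_log (by norm_num) ?_
      have : (4 / 3 : ℝ) ≤ 1 / (3 * γ) := by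
        rw [le_div_iff₀ (by positivity)]
        linarith
      refine le_trans (by norm_num) (pow_le_pow_left₀ (by norm_num) this 4)
    have h3 : Real.log (1 / γ) = Real.log 3 + Real.log (1 / (3 * γ)) := by
      rw [← Real.log_mul (by norm_num) (by positivity)]
      congr 1
      field_simp
    linarith
  have hLγ0 : 0 < Real.log (1 / γ) := Real.log_pos (by rw [lt_div_iff₀ hγ]; linarith)
  have hLε0 : 0 < Real.log (1 / ε) := Real.log_pos (by rw [lt_div_iff₀ hε0]; linarith)
  have hprod : Real.log (1 / ε) * Real.log (1 / γ) ≤ 2 ^ 17 * (t ^ 2 * 2 ^ t) := by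
    rcases le_total ε (1 / 2) with hε | hε
    · have hs4 : 1 / 4 ≤ s := by
        rcases hs with hs | hs <;> linarith
      have hlogs : Real.log (1 / s) ≤ 3 := by
        refine (Real.log_le_sub_one_of_pos (by positivity)).trans ?_
        have : 1 / s ≤ 4 := by
          rw [div_le_iff₀ hs0]
          linarith
        linarith
      have hsqrt : (1 / (500 * n : ℝ)) ^ t ≤ √ε := by
        have h1 := hk.trans (hdist hs4)
        have h2 : (1 / (500 * n : ℝ)) ^ t = (1 / 10) ^ t * (1 / (50 * n : ℝ)) ^ t := by
          rw [← mul_pow]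
          congr 1
          field_simp
          norm_num
        have h3 : (1 / 10 : ℝ) ^ t ≤ 1 / 10 := by
          rw [ht, pow_succ]
          have : (1 / 10 : ℝ) ^ u ≤ 1 := pow_le_one₀ (by norm_num) (by norm_num)
          linarith
        rw [h2]
        have h4 : (0 : ℝ) ≤ (1 / (50 * n : ℝ)) ^ t := by positivity
        nlinarith
      have hε2 : Real.log (1 / ε) ≤ 2 * (t * Real.log (500 * n)) := by
        have h1 := Real.log_le_log (by positivity) hsqrt
        rw [Real.log_pow, Real.log_sqrt hε0.le, one_div, Real.log_inv] at h1
        rw [one_div, Real.log_inv]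
        linarith
      have hlogn : Real.log (500 * n) ≤ 1500 * t := by
        refine (Real.log_le_sub_one_of_pos (by positivity)).trans ?_
        have : (n : ℝ) ≤ t + 2 := by exact_mod_cast hnt
        linarith
      have hε3 : Real.log (1 / ε) ≤ 3000 * t ^ 2 := by nlinarith
      have hγ3 : Real.log (1 / γ) ≤ 15 * 2 ^ t := by nlinarith
      calc Real.log (1 / ε) * Real.log (1 / γ) ≤ (3000 * t ^ 2) * (15 * 2 ^ t) :=
            mul_le_mul hε3 hγ3 hLγ0.le (by positivity)
        _ = 45000 * (t ^ 2 * 2 ^ t) := by ring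
        _ ≤ 2 ^ 17 * (t ^ 2 * 2 ^ t) :=
            mul_le_mul_of_nonneg_right (by norm_num) (by positivity)
    · have hε3 : Real.log (1 / ε) ≤ 2 * (1 - ε) := by
        refine (Real.log_le_sub_one_of_pos (by positivity)).trans ?_
        rw [sub_le_iff_le_add, div_le_iff₀ hε0]
        nlinarith
      have hlogs : Real.log (1 / s) ≤ 4 / (1 - ε) := by
        refine (Real.log_le_self (by positivity)).trans ?_
        rw [div_le_div_iff₀ hs0 hη]
        rcases hs with hs | hs <;> linarith
      have hγ3 : Real.log (1 / γ) ≤ 5 * (2 ^ t * (4 / (1 - ε))) :=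
        hLγ.trans (mul_le_mul_of_nonneg_left (mul_le_mul_of_nonneg_left hlogs h2t.le) (by norm_num))
      calc Real.log (1 / ε) * Real.log (1 / γ)
          ≤ (2 * (1 - ε)) * (5 * (2 ^ t * (4 / (1 - ε)))) :=
            mul_le_mul hε3 hγ3 hLγ0.le (by positivity)
        _ = 40 * (1 * 2 ^ t) := by
            field_simp
            norm_num
        _ ≤ 2 ^ 17 * (t ^ 2 * 2 ^ t) := by
            have : (1 : ℝ) ≤ t ^ 2 := one_le_pow₀ ht1
            gcongr
            norm_num
  rw [← Real.log_mul hLε0.ne' hLγ0.ne']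
  refine (Real.log_le_log (by positivity) hprod).trans ?_
  rw [Real.log_mul (by positivity) (by positivity), Real.log_mul (by positivity) (by positivity),
    Real.log_pow, Real.log_pow, Real.log_pow]
  have h1 : Real.log 2 ≤ 1 := by linarith [Real.log_two_lt_d9]
  have h2 : Real.log t ≤ t := Real.log_le_self (by positivity)
  push_cast
  nlinarith

end SlowStart

/-! ### The lower bound -/

section Lower

variable {n : ℕ} [NeZero n] {γ a : ℝ}

/-- A trajectory on which some agent stays idle up to time `P / 50` is not in approximate
equilibrium before time `(P + Q) / 100`. -/
theorem not_isApproxEquilibrium_of_idle (hn : 3 ≤ n) (hγ : 0 < γ) (hγ4 : γ < 1 / 4)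
    {ω : ℕ → Fin n} {P : ℝ}
    (hP : ∀ t : ℕ, (t : ℝ) < P / 50 → 0 < zeros (profile 1 a (slowStart n γ) ω t))
    {ε : ℝ} (hε0 : 0 < ε) (hε1 : ε < 1) {t : ℕ}
    (ht : (t : ℝ) < 1 / 100 * (P + max 0 (Real.log (Real.log (1 / ε))
      + Real.log (Real.log (1 / γ))))) :
    ¬ IsApproxEquilibrium 1 ε (profile 1 a (slowStart n γ) ω t) := by
  have hint₀ := interior_slowStart hn hγ hγ4
  have hint := hint₀.profile (a := a) ω t
  intro h
  rcases Nat.eq_zero_or_pos (zeros (profile 1 a (slowStart n γ) ω t)) with hz | hz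
  swap
  · exact hint.not_isApproxEquilibrium_of_zeros_pos hε1 hz h
  have h1 : P / 50 ≤ t := by
    by_contra! h1
    exact (hP t h1).ne' hz
  have h2 := hint₀.zeros_le_zeros_profile_add (a := a) ω t
  have h3 := le_zeros_slowStart hn γ
  have h4 := log_log_add_log_log_le hn hγ hγ4 ω (by omega) hε0 hε1 h
  have ht1 : (1 : ℝ) ≤ t := by
    have : 1 ≤ t := by omega
    exact_mod_cast this
  have h5 : max 0 (Real.log (Real.log (1 / ε)) + Real.log (Real.log (1 / γ))) ≤ 20 * (t : ℝ) :=
    max_le (by linarith) h4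
  linarith

/-- The probability that no agent is idle any more at time `T`. -/
theorem stepProb_zeros_le (hn : 3 ≤ n) (hγ : 0 < γ) (hγ4 : γ < 1 / 4) (T : ℕ) :
    stepProb (step 1 a) T (fun y => zeros y = 0) (slowStart n γ)
      ≤ Real.exp (T / n) / (n - 1) := by
  have hn3 : (3 : ℝ) ≤ n := by exact_mod_cast hn
  have h := stepProb_le_of_drift (F := step 1 a) (R := Interior) (fun y hy i => hy.step i)
    (V := fun y => ((zeros y : ℝ) + 1)⁻¹) (ρ := 1 + 1 / n) (m := 1) (by positivity) one_pos
    (fun y _ => by positivity) (fun y hy => hy.avg_inv_zeros_le)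
    (B := fun y => zeros y = 0) (fun y _ hy => by simp [hy]) T (interior_slowStart hn hγ hγ4)
  rw [div_one] at h
  refine h.trans ?_
  have hz : (n : ℝ) - 1 ≤ zeros (slowStart n γ) + 1 := by
    have h1 := le_zeros_slowStart hn γ
    have h2 : n ≤ zeros (slowStart n γ) + 2 := by omega
    have h3 : (n : ℝ) ≤ zeros (slowStart n γ) + 2 := by exact_mod_cast h2
    linarith
  have hexp : (1 + 1 / (n : ℝ)) ^ T ≤ Real.exp (T / n) := by
    calc (1 + 1 / (n : ℝ)) ^ T ≤ Real.exp (1 / n) ^ T :=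
          pow_le_pow_left₀ (by positivity) (by linarith [Real.add_one_le_exp (1 / (n : ℝ))]) T
      _ = Real.exp (T / n) := by rw [← Real.exp_nat_mul, mul_one_div]
  rw [div_eq_mul_inv]
  exact mul_le_mul hexp (inv_anti₀ (by linarith) hz) (by positivity) (Real.exp_pos _).le

/-- Coupon collecting: with probability at least `1 - δ` some agent is idle up to time of the order
`n * log (n * δ)`. -/
theorem one_sub_le_measureReal_of_idle (hn : 3 ≤ n) (hγ : 0 < γ) (hγ4 : γ < 1 / 4) {δ : ℝ} (hδ0 : 0 < δ)
    {E : Set (ℕ → Fin n)}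
    (hE : ∀ ω : ℕ → Fin n, (∀ t : ℕ, (t : ℝ) < n * max 0 (Real.log (n * δ)) / 50 →
      0 < zeros (profile 1 a (slowStart n γ) ω t)) → ω ∈ E) :
    1 - δ ≤ (uniformMovers n).real E := by
  have hn3 : (3 : ℝ) ≤ n := by exact_mod_cast hn
  have hint := interior_slowStart hn hγ hγ4
  have hD0 : 0 < n * δ := by positivity
  rcases lt_or_ge (n * δ) (9 / 4) with hD | hD
  · -- so few moves cannot reach all the idle agents
    have : E = Set.univ := Set.eq_univ_of_forall fun ω => hE ω fun t ht => by
      have h1 : Real.log (n * δ) ≤ 5 / 4 := by linarith [Real.log_le_sub_one_of_pos hD0]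
      have h2 : max 0 (Real.log (n * δ)) ≤ 5 / 4 := max_le (by norm_num) h1
      have h3 : (t : ℝ) + 2 < n := by nlinarith
      have h4 : t + 2 < n := by exact_mod_cast h3
      have h5 := hint.zeros_le_zeros_profile_add (a := a) ω t
      have h6 := le_zeros_slowStart hn γ
      omega
    rw [this, probReal_univ]
    linarith
  · set L := Real.log (n * δ) with hL
    have hL0 : 0 ≤ L := Real.log_nonneg (by linarith)
    rw [max_eq_right hL0] at hE
    set T := ⌊n * L / 50⌋₊ with hT
    have hTle : (T : ℝ) ≤ n * L / 50 := Nat.floor_le (by positivity)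
    have hprob : stepProb (step 1 a) T (fun y => zeros y = 0) (slowStart n γ) ≤ δ := by
      refine (stepProb_zeros_le hn hγ hγ4 T).trans ?_
      set q := Real.exp (L / 2) with hq
      have hq0 : 0 < q := Real.exp_pos _
      have hqD : q ^ 2 = n * δ := by
        rw [hq, ← Real.exp_nat_mul, ← Real.exp_log hD0, ← hL]
        congr 1
        push_cast
        ring
      have hq1 : 3 / 2 ≤ q := abs_le_of_sq_le_sq' (by rw [hqD]; linarith) hq0.le |>.2
      have hexp : Real.exp (T / n) ≤ q := by
        rw [hq, Real.exp_le_exp, div_le_iff₀ (by linarith)]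
        nlinarith
      rw [div_le_iff₀ (by linarith)]
      have h1 : q * n ≤ δ * (n - 1) * n := by
        calc q * n ≤ q * (q * (n - 1)) := mul_le_mul_of_nonneg_left (by nlinarith) hq0.le
          _ = q ^ 2 * (n - 1) := by ring
          _ = δ * (n - 1) * n := by rw [hqD]; ring
      exact hexp.trans (le_of_mul_le_mul_right h1 (by linarith))
    refine one_sub_le_measureReal hprob fun ω hω => hE ω fun t ht => ?_
    have htT : t ≤ T := Nat.le_floor ht.le
    exact (Nat.pos_of_ne_zero hω).trans_le (hint.zeros_profile_antitone ω htT)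

theorem lower_bound (hn : 3 ≤ n) {κ : ℝ} (hκ : 0 < κ) (ha : κ * a < 1 / 4) (hγ : 0 < γ)
    (hγa : γ ≤ κ * a) :
    ∃ x₀ : Fin n → ℝ, (∀ i, 0 ≤ x₀ i) ∧ startParam κ a x₀ = γ ∧
      ∀ ε δ : ℝ, 0 < ε → ε < 1 → 0 < δ → δ < 1 →
        1 - δ ≤ (uniformMovers n).real {i | ∀ t : ℕ,
          (t : ℝ) < 1 / 100 * (n * max 0 (Real.log (n * δ))
            + max 0 (Real.log (Real.log (1 / ε)) + Real.log (Real.log (1 / γ)))) →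
          ¬ IsApproxEquilibrium κ ε (profile κ a x₀ i t)} := by
  have hγ4 : γ < 1 / 4 := hγa.trans_lt ha
  set x₀ : Fin n → ℝ := fun k => slowStart n γ k / κ with hx₀
  have hmul : (fun k => κ * x₀ k) = slowStart n γ := by
    funext k
    exact mul_div_cancel₀ _ hκ.ne'
  refine ⟨x₀, fun k => div_nonneg (slowStart_nonneg hγ k) hκ.le, ?_, ?_⟩
  · rw [← startParam_mul, hmul, startParam_slowStart hn hγ hγa ha]
  · intro ε δ hε0 hε1 hδ0 _
    refine one_sub_le_measureReal_of_idle (a := κ * a) hn hγ hγ4 hδ0 fun ω hω t ht => ?_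
    rw [← isApproxEquilibrium_mul hκ, mul_profile hκ, hmul]
    exact not_isApproxEquilibrium_of_idle hn hγ hγ4 hω hε0 hε1 ht

end Lower

end LotteryContest

theorem mainTheorem3 :
    (∃ C : ℝ, 0 < C ∧
      ∀ (n : ℕ) [NeZero n], 3 ≤ n →
      ∀ κ a : ℝ, 0 < κ → 0 < a → κ * a < 1 / 4 →
      ∀ x₀ : Fin n → ℝ, (∀ i, 0 ≤ x₀ i) →
      ∀ ε δ : ℝ, 0 < ε → ε < 1 → 0 < δ → δ < 1 →
        1 - δ ≤ (LotteryContest.uniformMovers n).real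
          {i | ∃ t : ℕ,
            (t : ℝ) ≤ C * (Real.log (Real.log (1 / LotteryContest.startParam κ a x₀))
              + n * Real.log (n / (ε * δ))) ∧
            LotteryContest.IsApproxEquilibrium κ ε (LotteryContest.profile κ a x₀ i t)}) ∧
    (∃ c : ℝ, 0 < c ∧
      ∀ (n : ℕ) [NeZero n], 3 ≤ n →
      ∀ κ a : ℝ, 0 < κ → 0 < a → κ * a < 1 / 4 →
      ∀ γ : ℝ, 0 < γ → γ ≤ κ * a →
      ∃ x₀ : Fin n → ℝ, (∀ i, 0 ≤ x₀ i) ∧ LotteryContest.startParam κ a x₀ = γ ∧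
        ∀ ε δ : ℝ, 0 < ε → ε < 1 → 0 < δ → δ < 1 →
          1 - δ ≤ (LotteryContest.uniformMovers n).real
            {i | ∀ t : ℕ,
              (t : ℝ) < c * (n * max 0 (Real.log (n * δ))
                + max 0 (Real.log (Real.log (1 / ε)) + Real.log (Real.log (1 / γ)))) →
              ¬ LotteryContest.IsApproxEquilibrium κ ε
                (LotteryContest.profile κ a x₀ i t)}) := by
  refine ⟨⟨100, by norm_num, ?_⟩, ⟨1 / 100, by norm_num, ?_⟩⟩
  · intro n _ hn κ a hκ ha0 ha x₀ hx ε δ hε0 hε1 hδ0 hδ1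
    exact LotteryContest.upper_bound hn hκ ha0 ha hx hε0 hε1 hδ0 hδ1
  · intro n _ hn κ a hκ _ ha γ hγ hγa
    exact LotteryContest.lower_bound hn hκ ha hγ hγa
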